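/- **Setting.** Let $H(\mathbb T^n)=\mathbb C[z_1^{\pm1},\dots,z_n^{\pm1}]$ with its standard Hopf algebra structure ($z^k=\prod z_i^{k_i}$ group-like), and let $\mathcal A$ be a unital complex $*$-algebra which is a principal right $H(\mathbb T^n)$-comodule algebra with coaction $\Delta_R$: there is a linear $\ell:H(\mathbb T^n)\to\mathcal A\otimes\mathcal A$ with $\ell(1)=1\otimes1$, $m\circ\ell=\varepsilon$, $(\ell\otimes\mathrm{id})\Delta=(\mathrm{id}\otimes\Delta_R)\ell$ and $(S\otimes\ell)\Delta=(\sigma\otimes\mathrm{id})(\Delta_R\otimes\mathrm{id})\ell$, $\sigma$ being the flip $\mathcal A\otimes H(\mathbb T^n)\to H(\mathbb T^n)\otimes\mathcal A$. Put $\mathcal A^{(k)}=\{a:\Delta_R(a)=a\otimes z^k\}$ for $k\in\mathbb Z^n$, $\mathcal B=\mathcal A^{(0)}$, and let $\delta_j:\mathcal A\to\mathcal A$ be the derivation with $\delta_j(a)=k_ja$ on $\mathcal A^{(k)}$. Let $(\mathcal A,\mathcal H,D,J,\gamma)$ be a real spectral triple of $KR$-dimension $d$ ($\gamma=1$ if $d$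 is odd): $\mathcal A$ is represented by bounded operators on the Hilbert space $\mathcal H$; $D$ is self-adjoint, has bounded commutators with $\mathcal A$ (whose elements preserve $\mathrm{Dom}\,D$), and $D^{-1}$ is compact on $(\ker D)^\perp$; $J$ is antiunitary with $J^2=\epsilon$, $JD=\epsilon'DJ$, where $\epsilon=-1$ iff $d\equiv2,3,4,5\pmod 8$ and $\epsilon'=-1$ iff $d\equiv1\pmod 4$; for $d$ even $\gamma$ is a self-adjoint unitary commuting with $\mathcal A$ and anticommuting with $D$, and $J\gamma=\epsilon''\gamma J$, where $\epsilon''=-1$ iff $d\equiv2\pmod4$; moreover $[a,Jb^*J^{-1}]=0$ and $[[D,a],Jb^*J^{-1}]=0$ for all $a,b\in\mathcal A$. Put $ha=Ja^*J^{-1}h$ for $a\in\mathcal A$, and $h\eta=-\epsilon' J\eta^*J^{-1}h$ for one-forms $\eta$, so that $h[D,b]=D(hb)-(Dh)b$ for $h\in\mathrm{Dom}\,D$. For a subalgebra $\mathcal C\subseteq\mathcal A$ let $\Omega^1_D(\mathcal C)$ be the linear span of the operators $a[D,b]$, $a,b\in\mathcal C$, and write $da=[D,a]$. The triple is $\mathbb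 T^n$-equivariant: there are strongly commuting self-adjoint operators $\delta_1,\dots,\delta_n$ on $\mathcal H$, each with spectrum $\mathbb Z$ and with domain stable under $\mathcal A$, such that $\delta_j(a\psi)=\delta_j(a)\psi+a\,\delta_j\psi$, $\delta_jJ=-J\delta_j$, $[\delta_j,\gamma]=0$, and $\delta_j$ commutes strongly with $D$. (A self-adjoint operator commutes strongly with $T$ if its resolvents $R$ at non-real points satisfy $RT\subseteq TR$.) Let $\mathcal H_k=\{x:\delta_jx=k_jx\ \forall j\}$. The triple is projectable: there is a bounded $\Gamma=\Gamma^*$ with $\Gamma^2=1$, commuting with $\mathcal A$ and with all $\delta_j$, such that, if $d$ is odd, $J\Gamma=\Gamma J$ when $d-n\equiv0\pmod4$ and $J\Gamma=-\Gamma J$ otherwise, and, if $d$ is even, $J\Gamma=-\Gamma J$ and $\Gamma\gamma=(-1)^n\gamma\Gamma$. Put $D_h=\frac12\left(D+(-1)^n\Gamma D\Gamma\right)$. The fibres are isometric: $D=D_v+D_h+Z$ (as unbounded operators, with equality of domains), where $D_v$ vanishes on $\mathcal H_0\cap\mathrm{Dom}\,D_v$, commutes with $\Gamma$ for $n$ odd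 and anticommutes with $\Gamma$ for $n$ even, every $\delta_j$ commutes strongly with $D_v$, $Z$ is bounded and commutes with $\mathcal A$, and there is a bounded self-adjoint $Z'$ with $Ja^*J^{-1}Z=Z'Ja^*J^{-1}$ for all $a\in\mathcal A$. Let $D_0$ be the restriction of $D_h$ to $\mathcal H_0$. Let $\omega_1,\dots,\omega_n\in\Omega^1_D(\mathcal A)$ be a strong $\mathbb T^n$-connection: (i) $\delta_j(\omega_i)=0$, i.e. $\omega_i$ commutes with $\delta_j$ on $\mathcal H$; (ii) whenever $\omega_i=\sum_jp_j\,dq_j$, then $\sum_jp_j\delta_i(q_j)=1$ and $\sum_jp_j\delta_l(q_j)=0$ for $l\ne i$; (iii) $da-\sum_i\delta_i(a)\omega_i\in\Omega^1_D(\mathcal B)\mathcal A$ for all $a\in\mathcal A$. For $p\in\mathcal A^{(k)}$ put $\nabla_\omega(p)=[D,p]-\sum_ik_i\,p\,\omega_i$. **Proposition.** (1) For each $k\in\mathbb Z^n$ the rule $$D^{(k)}_\omega(hp)=(D_0h)p+h\nabla_\omega(p),\qquad h\in\mathrm{Dom}\,D_0,\ p\in\mathcal A^{(k)},$$ gives a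 well-defined linear operator on the linear span of these vectors $hp$, which is a dense subspace of $\mathcal H_k$, with values in $\mathcal H_k$. $\mathcal H$ is the Hilbert space direct sum of the $\mathcal H_k$, and the algebraic direct sum of the operators $D^{(k)}_\omega$ is closable. Let $D_\omega$ be its closure. (2) If all $\omega_i$ are self-adjoint, then $D_\omega$ is self-adjoint. (3) $D_\omega$ has bounded commutators with all elements of $\mathcal A$: every $a\in\mathcal A$ preserves $\mathrm{Dom}\,D_\omega$, and $[D_\omega,a]$ is the restriction to $\mathrm{Dom}\,D_\omega$ of a bounded operator on $\mathcal H$. -/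

import Mathlib

open scoped TensorProduct

noncomputable section

/-! ### Unbounded operators and commutation -/

section Operators

variable {H : Type*} [NormedAddCommGroup H] [InnerProductSpace ℂ H]

/-- `S` is the (everywhere defined, bounded) commutator `[T, a]`: the bounded operator `a` preserves
`Dom T` and `T a x - a T x = S x` for all `x ∈ Dom T`. -/
def IsCommutator (T : H →ₗ.[ℂ] H) (a S : H →L[ℂ] H) : Prop :=
  ∀ x : T.domain, ∃ h : a (x : H) ∈ T.domain, T ⟨a (x : H), h⟩ - a (T x) = S (x : H)

open Classical in
/-- The bounded extension of the commutator `[T, a]` (it is unique when `Dom T` is dense), and `0`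
when `[T, a]` is not bounded. -/
def boundedCommutator (T : H →ₗ.[ℂ] H) (a : H →L[ℂ] H) : H →L[ℂ] H :=
  if h : ∃ S, IsCommutator T a S then h.choose else 0

/-- `T j = c j T` for a conjugate-linear `j` (which in particular preserves `Dom T`). -/
def IntertwinesUpTo (c : ℤ) (T : H →ₗ.[ℂ] H) (j : H ≃ₗᵢ⋆[ℂ] H) : Prop :=
  ∀ x : T.domain, ∃ h : j (x : H) ∈ T.domain, T ⟨j (x : H), h⟩ = c • j (T x)

/-- `T a = c a T` for a bounded operator `a` (which in particular preserves `Dom T`). -/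
def CommutesUpTo (c : ℤ) (T : H →ₗ.[ℂ] H) (a : H →L[ℂ] H) : Prop :=
  ∀ x : T.domain, ∃ h : a (x : H) ∈ T.domain, T ⟨a (x : H), h⟩ = c • a (T x)

/-- `R = (T - z)⁻¹`. -/
def IsResolventAt (T : H →ₗ.[ℂ] H) (z : ℂ) (R : H →L[ℂ] H) : Prop :=
  (∀ y : H, ∃ h : R y ∈ T.domain, T ⟨R y, h⟩ - z • R y = y) ∧
    ∀ x : T.domain, R (T x - z • (x : H)) = x

/-- The spectrum of an unbounded operator: the complement of its resolvent set. -/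
def unboundedSpectrum (T : H →ₗ.[ℂ] H) : Set ℂ :=
  {z | ¬ ∃ R : H →L[ℂ] H, IsResolventAt T z R}

/-- A self-adjoint operator `S` commutes with a (possibly unbounded) operator `T`, in the usual
(strong) sense: the resolvents `R = (S - z)⁻¹`, `z ∉ ℝ`, satisfy `R T ⊆ T R`. -/
def StronglyCommutes (S T : H →ₗ.[ℂ] H) : Prop :=
  ∀ (z : ℂ) (R : H →L[ℂ] H), z.im ≠ 0 → IsResolventAt S z R →
    ∀ x : T.domain, ∃ h : R (x : H) ∈ T.domain, T ⟨R (x : H), h⟩ = R (T x)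

/-- The operator `T a` with domain `{x | a x ∈ Dom T}`, for `a` bounded. -/
def compBounded (T : H →ₗ.[ℂ] H) (a : H →L[ℂ] H) : H →ₗ.[ℂ] H where
  domain := T.domain.comap (a : H →ₗ[ℂ] H)
  toFun := T.toFun ∘ₗ (a : H →ₗ[ℂ] H).restrict (fun _ hx => hx)

/-- The operator `a T` with domain `Dom T`, for `a` bounded. -/
def boundedComp (a : H →L[ℂ] H) (T : H →ₗ.[ℂ] H) : H →ₗ.[ℂ] H :=
  (a : H →ₗ[ℂ] H).compPMap T

/-- The kernel of an unbounded operator. -/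
def unboundedKer (T : H →ₗ.[ℂ] H) : Submodule ℂ H :=
  (LinearMap.ker T.toFun).map T.domain.subtype

end Operators

/-! ### Principal comodule algebras over the Hopf algebra of the torus -/

/-- The Hopf algebra `H(𝕋ⁿ)`: Laurent polynomials in `n` commuting variables, that is, the group
algebra of `ℤⁿ`, with group-like monomials. -/
abbrev TorusHopf (n : ℕ) : Type := AddMonoidAlgebra ℂ (Fin n → ℤ)

/-- The monomial `z^k`. -/
def torusMonomial {n : ℕ} (k : Fin n → ℤ) : TorusHopf n := AddMonoidAlgebra.single k 1

/-- The linear functional `z^k ↦ k_j` on `H(𝕋ⁿ)`: the derivative at the unit along the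
`j`-th generator of the Lie algebra of `𝕋ⁿ`. -/
def torusLieGenerator {n : ℕ} (j : Fin n) : TorusHopf n →ₗ[ℂ] ℂ :=
  (Finsupp.lsum ℂ fun k : Fin n → ℤ => (k j : ℂ) • (LinearMap.id : ℂ →ₗ[ℂ] ℂ)) ∘ₗ
    (AddMonoidAlgebra.coeffLinearEquiv ℂ).toLinearMap

/-- A right `H(𝕋ⁿ)`-comodule algebra. -/
structure TorusComoduleAlgebra (n : ℕ) (A : Type*) [Ring A] [Algebra ℂ A] where
  /-- The coaction. -/
  coact : A →ₐ[ℂ] A ⊗[ℂ] TorusHopf n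
  coassoc : (TensorProduct.assoc ℂ A (TorusHopf n) (TorusHopf n)).toLinearMap ∘ₗ
      coact.toLinearMap.rTensor (TorusHopf n) ∘ₗ coact.toLinearMap =
    (Coalgebra.comul (R := ℂ) (A := TorusHopf n)).lTensor A ∘ₗ coact.toLinearMap
  counit : (TensorProduct.rid ℂ A).toLinearMap ∘ₗ
      (Coalgebra.counit (R := ℂ) (A := TorusHopf n)).lTensor A ∘ₗ coact.toLinearMap =
    LinearMap.id

namespace TorusComoduleAlgebra

variable {n : ℕ} {A : Type*} [Ring A] [Algebra ℂ A] (C : TorusComoduleAlgebra n A)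

/-- Principality: existence of a strong connection map `ℓ : H(𝕋ⁿ) → A ⊗ A`. -/
def IsPrincipal : Prop :=
  ∃ l : TorusHopf n →ₗ[ℂ] A ⊗[ℂ] A,
    l 1 = 1 ⊗ₜ[ℂ] 1 ∧
    (∀ h, LinearMap.mul' ℂ A (l h) =
      algebraMap ℂ A (Coalgebra.counit (R := ℂ) (A := TorusHopf n) h)) ∧
    (TensorProduct.assoc ℂ A A (TorusHopf n)).toLinearMap ∘ₗ
        l.rTensor (TorusHopf n) ∘ₗ Coalgebra.comul (R := ℂ) (A := TorusHopf n) =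
      C.coact.toLinearMap.lTensor A ∘ₗ l ∧
    TensorProduct.map (HopfAlgebra.antipode ℂ (A := TorusHopf n)) l ∘ₗ
        Coalgebra.comul (R := ℂ) (A := TorusHopf n) =
      (TensorProduct.assoc ℂ (TorusHopf n) A A).toLinearMap ∘ₗ
        (TensorProduct.comm ℂ A (TorusHopf n)).toLinearMap.rTensor A ∘ₗ
        C.coact.toLinearMap.rTensor A ∘ₗ l

/-- The homogeneous subspace `A^(k)`. -/
def homogeneous (k : Fin n → ℤ) : Submodule ℂ A :=
  LinearMap.eqLocus C.coact.toLinearMap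
    ((TensorProduct.mk ℂ A (TorusHopf n)).flip (torusMonomial k))

/-- The derivation `δ_j` of `A`; it is multiplication by `k_j` on `A^(k)`. -/
def deriv (j : Fin n) : A →ₗ[ℂ] A :=
  (TensorProduct.rid ℂ A).toLinearMap ∘ₗ (torusLieGenerator j).lTensor A ∘ₗ C.coact.toLinearMap

end TorusComoduleAlgebra

/-! ### Real spectral triples -/

/-- `J² = ε`. -/
def krEps (d : ℕ) : ℤ :=
  if d % 8 = 2 ∨ d % 8 = 3 ∨ d % 8 = 4 ∨ d % 8 = 5 then -1 else 1

/-- `J D = ε' D J`. -/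
def krEps' (d : ℕ) : ℤ := if d % 4 = 1 then -1 else 1

/-- `J γ = ε'' γ J` (for even dimension). -/
def krEps'' (d : ℕ) : ℤ := if d % 4 = 2 then -1 else 1

section Opposite

variable {H : Type*} [NormedAddCommGroup H] [InnerProductSpace ℂ H] [CompleteSpace H]

/-- `J T* J⁻¹` as a bounded operator. -/
def conjAdjoint (J : H ≃ₗᵢ⋆[ℂ] H) (T : H →L[ℂ] H) : H →L[ℂ] H :=
  (J.toContinuousLinearEquiv : H →L⋆[ℂ] H).comp
    ((ContinuousLinearMap.adjoint T).comp (J.symm.toContinuousLinearEquiv : H →L⋆[ℂ] H))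

end Opposite

/-- A real spectral triple of `KR`-dimension `d` (mod 8); in the odd case `γ = 1`. -/
structure RealSpectralTriple (A : Type*) [Ring A] [StarRing A] [Algebra ℂ A] [StarModule ℂ A]
    (H : Type*) [NormedAddCommGroup H] [InnerProductSpace ℂ H] [CompleteSpace H] (d : ℕ) where
  /-- The representation. -/
  π : A →⋆ₐ[ℂ] (H →L[ℂ] H)
  /-- The Dirac operator. -/
  D : H →ₗ.[ℂ] H
  /-- The real structure, an antiunitary operator. -/
  J : H ≃ₗᵢ⋆[ℂ] H
  /-- The grading. -/
  γ : H →L[ℂ] H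
  selfAdjoint : IsSelfAdjoint D
  bounded_commutator : ∀ a, ∃ S, IsCommutator D (π a) S
  /-- `D⁻¹` is compact on the orthogonal complement of the kernel. -/
  compact_inverse : ∃ K : H →L[ℂ] H, IsCompactOperator K ∧
    ∀ y ∈ (unboundedKer D)ᗮ, K y ∈ (unboundedKer D)ᗮ ∧
      ∃ h : K y ∈ D.domain, D ⟨K y, h⟩ = y
  J_sq : ∀ x, J (J x) = krEps d • x
  J_D : IntertwinesUpTo (krEps' d) D J
  commutant : ∀ a b, Commute (π a) (conjAdjoint J (π b))
  first_order : ∀ a b, Commute (boundedCommutator D (π a)) (conjAdjoint J (π b))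
  odd_grading : Odd d → γ = 1
  even_grading_sq : Even d → γ * γ = 1
  even_grading_selfAdjoint : Even d → IsSelfAdjoint γ
  even_grading_commute : Even d → ∀ a, Commute γ (π a)
  even_grading_D : Even d → CommutesUpTo (-1) D γ
  even_grading_J : Even d → ∀ x, J (γ x) = krEps'' d • γ (J x)

namespace RealSpectralTriple

variable {A : Type*} [Ring A] [StarRing A] [Algebra ℂ A] [StarModule ℂ A]
  {H : Type*} [NormedAddCommGroup H] [InnerProductSpace ℂ H] [CompleteSpace H] {d : ℕ}
  (T : RealSpectralTriple A H d)

/-- The differential `da = [D, a]`. -/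
def diff (a : A) : H →L[ℂ] H := boundedCommutator T.D (T.π a)

/-- The operator `h ↦ h a = J a* J⁻¹ h` of the right action of `A`. -/
def rightMul (a : A) : H →L[ℂ] H := conjAdjoint T.J (T.π a)

/-- The operator `h ↦ h η` of the right action of one-forms. The sign is the one for which
`h [D, b] = D (h b) - (D h) b`; it is `h η = - J η* J⁻¹ h` when `J D = D J`. -/
def rightForm (η : H →L[ℂ] H) : H →L[ℂ] H := (-krEps' d) • conjAdjoint T.J η

/-- The one-forms `Ω¹_D(B)` of a subspace `B` of `A`: the span of all `a [D, b]`, `a, b ∈ B`. -/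
def oneForms (B : Submodule ℂ A) : Submodule ℂ (H →L[ℂ] H) :=
  Submodule.span ℂ {η | ∃ a ∈ B, ∃ b ∈ B, η = T.π a * T.diff b}

/-- `Ω¹_D(B) A`. -/
def oneFormsMul (B : Submodule ℂ A) : Submodule ℂ (H →L[ℂ] H) :=
  Submodule.span ℂ {ζ | ∃ η ∈ T.oneForms B, ∃ a : A, ζ = η * T.π a}

/-- `𝕋ⁿ`-equivariance of a real spectral triple: the infinitesimal generators `δ_j` on `H`. -/
structure TorusEquivariance {n : ℕ} (C : TorusComoduleAlgebra n A) where
  /-- The generators. -/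
  δ : Fin n → H →ₗ.[ℂ] H
  selfAdjoint : ∀ j, IsSelfAdjoint (δ j)
  commute : ∀ i j, StronglyCommutes (δ i) (δ j)
  /-- `A` preserves `Dom δ_j` and `δ_j (a ψ) = δ_j(a) ψ + a δ_j ψ`. -/
  leibniz : ∀ j a, IsCommutator (δ j) (T.π a) (T.π (C.deriv j a))
  anticommute_J : ∀ j, IntertwinesUpTo (-1) (δ j) T.J
  commute_γ : ∀ j, CommutesUpTo 1 (δ j) T.γ
  commute_D : ∀ j, StronglyCommutes (δ j) T.D
  spectrum_eq : ∀ j, unboundedSpectrum (δ j) = Set.range (fun m : ℤ => (m : ℂ))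

/-- `D_h = ½ Γ (Γ D + (-1)ⁿ D Γ) = ½ (D + (-1)ⁿ Γ D Γ)`, with domain `{x ∈ Dom D | Γ x ∈ Dom D}`. -/
def horizontalDirac (n : ℕ) (Γ : H →L[ℂ] H) : H →ₗ.[ℂ] H :=
  (1 / 2 : ℂ) • boundedComp Γ (boundedComp Γ T.D + (-1 : ℂ) ^ n • compBounded T.D Γ)

namespace TorusEquivariance

variable {T} {n : ℕ} {C : TorusComoduleAlgebra n A} (E : T.TorusEquivariance C)

/-- The joint eigenspace `H_k = {x | δ_j x = k_j x for all j}`. -/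
def weightSpace (k : Fin n → ℤ) : Submodule ℂ H :=
  ⨅ j, (E.δ j).graph.comap (LinearMap.prod LinearMap.id ((k j : ℂ) • LinearMap.id))

/-- `Γ` is a grading along which the triple is projectable. -/
structure IsProjectable (Γ : H →L[ℂ] H) : Prop where
  sq : Γ * Γ = 1
  selfAdjoint : IsSelfAdjoint Γ
  commute_π : ∀ a, Commute Γ (T.π a)
  commute_δ : ∀ j, CommutesUpTo 1 (E.δ j) Γ
  /-- The base has dimension `d - n`. -/
  odd_J : Odd d → (d : ℤ) ≡ n [ZMOD 4] → ∀ x, T.J (Γ x) = Γ (T.J x)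
  odd_J' : Odd d → ¬ (d : ℤ) ≡ n [ZMOD 4] → ∀ x, T.J (Γ x) = -Γ (T.J x)
  even_J : Even d → ∀ x, T.J (Γ x) = -Γ (T.J x)
  even_γ : Even d → Γ * T.γ = (-1 : ℂ) ^ n • (T.γ * Γ)

/-- The isometric fibres condition. -/
def HasIsometricFibres (Γ : H →L[ℂ] H) : Prop :=
  ∃ (Dv : H →ₗ.[ℂ] H) (Z : H →L[ℂ] H),
    T.D = (Z : H →ₗ[ℂ] H) +ᵥ (Dv + T.horizontalDirac n Γ) ∧
    (∀ x : Dv.domain, (x : H) ∈ E.weightSpace 0 → Dv x = 0) ∧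
    CommutesUpTo (-(-1) ^ n) Dv Γ ∧
    (∀ j, StronglyCommutes (E.δ j) Dv) ∧
    (∀ a, Commute Z (T.π a)) ∧
    ∃ Z' : H →L[ℂ] H, IsSelfAdjoint Z' ∧ ∀ a, T.rightMul a * Z = Z' * T.rightMul a

/-- `D_0`, the restriction of the horizontal Dirac operator to `H_0`. -/
def baseDirac (Γ : H →L[ℂ] H) : H →ₗ.[ℂ] H :=
  (T.horizontalDirac n Γ).domRestrict (E.weightSpace 0)

/-- A strong `𝕋ⁿ`-connection for the Dirac calculus. The action of `δ_j` on a one-form `η` is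
the commutator `[δ_j, η]`. -/
structure IsStrongConnection (ω : Fin n → H →L[ℂ] H) : Prop where
  mem : ∀ i, ω i ∈ T.oneForms ⊤
  invariant : ∀ i j, IsCommutator (E.δ j) (ω i) 0
  vertical : ∀ (i : Fin n) (r : ℕ) (p q : Fin r → A), ω i = ∑ t, T.π (p t) * T.diff (q t) →
    ∀ l, ∑ t, p t * C.deriv l (q t) = if l = i then 1 else 0
  strong : ∀ a, T.diff a - ∑ i, T.π (C.deriv i a) * ω i ∈ T.oneFormsMul (C.homogeneous 0)

variable (Γ : H →L[ℂ] H) (ω : Fin n → H →L[ℂ] H)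

/-- The connection `∇_ω(p) = [D, p] - ∑ k_i p ω_i` on `A^(k)`. -/
def connection (k : Fin n → ℤ) (p : A) : H →L[ℂ] H :=
  T.diff p - ∑ i, (k i : ℂ) • (T.π p * ω i)

/-- The linear relation spanned by the prescription `h p ↦ (D_0 h) p + h ∇_ω(p)` for
`h ∈ Dom D_0` and `p ∈ A^(k)`. -/
def twistRelation (k : Fin n → ℤ) : Submodule ℂ (H × H) :=
  Submodule.span ℂ {v | ∃ (h : (E.baseDirac Γ).domain) (p : A), p ∈ C.homogeneous k ∧
    v = (T.rightMul p (h : H),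
      T.rightMul p (E.baseDirac Γ h) + T.rightForm (connection (T := T) ω k p) (h : H))}

/-- The twist `D_ω^(k)` of `D_0` by `∇_ω` on `A^(k)`. -/
def twist (k : Fin n → ℤ) : H →ₗ.[ℂ] H := (E.twistRelation Γ ω k).toLinearPMap

/-- The algebraic direct sum of the operators `D_ω^(k)`. -/
def twistSum : H →ₗ.[ℂ] H := (⨆ k, (E.twist Γ ω k).graph).toLinearPMap

/-- The twisted Dirac operator `D_ω`. -/
def twistedDirac : H →ₗ.[ℂ] H := (E.twistSum Γ ω).closure

end TorusEquivariance

end RealSpectralTriple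

end

/-!
Let `P` be the orthogonal projection onto the weight space `H_k`. It commutes with every closed
operator that commutes strongly with the `δ_j`: the eigenspace of `δ_j` for a real number is the
fixed space of a contraction, a multiple of a resolvent of `δ_j`, so that `H_k` is the fixed space
of an average of contractions, and `P` is by the mean ergodic theorem a strong limit of polynomials
in resolvents. The weight spaces exhaust `H`, since the spectrum of every `δ_j` is discrete.

On `H_0` the vertical operator vanishes, so `D_0` is `D - Z` there. A principal coaction satisfies
`1 ∈ A^(-k) A^(k)`, so the vectors `h p` with `h ∈ Dom D_0` and `p ∈ A^(k)` span `Dom D ∩ H_k`.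
The Leibniz rule `D (h p) = (D h) p + h [D, p]` then identifies `D_ω^(k)` with the restriction to
`H_k` of `D - Z - ∑ k_i R_i`, where `R_i` is the right action of `ω_i` and preserves `H_k`. This is
a bounded perturbation of the part of `D` in the reducing subspace `H_k`, hence closed, and
self-adjoint if the `ω_i` are. The direct sum over `k` inherits both properties, however fast the
perturbations grow in `k`. In a commutator with `a ∈ A^(l)` this growth cancels: what remains is
`[D, a] - ∑ l_i R_i a`, which does not depend on `k`.
-/

noncomputable section

/-! ### Graphs and commutators of unbounded operators -/

section Graph

theorem mem_graph_iff_exists {R E F : Type*} [Ring R] [AddCommGroup E] [Module R E]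
    [AddCommGroup F] [Module R F] {T : E →ₗ.[R] F} {x : E} {y : F} :
    (x, y) ∈ T.graph ↔ ∃ h : x ∈ T.domain, T ⟨x, h⟩ = y := by
  rw [LinearPMap.mem_graph_iff]
  constructor
  · rintro ⟨⟨u, hu⟩, rfl, rfl⟩
    exact ⟨hu, rfl⟩
  · rintro ⟨h, rfl⟩
    exact ⟨⟨x, h⟩, rfl, rfl⟩

variable {H : Type*} [NormedAddCommGroup H] [InnerProductSpace ℂ H]
  {S T : H →ₗ.[ℂ] H} {a b U V : H →L[ℂ] H} {x y : H}

theorem isCommutator_iff_mem_graph :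
    IsCommutator T a U ↔ ∀ ⦃x y⦄, (x, y) ∈ T.graph → (a x, a y + U x) ∈ T.graph := by
  constructor
  · intro h x y hxy
    obtain ⟨hx, rfl⟩ := mem_graph_iff_exists.1 hxy
    obtain ⟨hax, hTax⟩ := h ⟨x, hx⟩
    exact mem_graph_iff_exists.2 ⟨hax, sub_eq_iff_eq_add'.1 hTax⟩
  · intro h x
    obtain ⟨hax, hTax⟩ := mem_graph_iff_exists.1 (h (T.mem_graph x))
    exact ⟨hax, sub_eq_iff_eq_add'.2 hTax⟩

theorem isCommutator_zero_iff_mem_graph :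
    IsCommutator T a 0 ↔ ∀ ⦃x y⦄, (x, y) ∈ T.graph → (a x, a y) ∈ T.graph := by
  simp only [isCommutator_iff_mem_graph, zero_apply, add_zero]

namespace IsCommutator

theorem mem_graph (h : IsCommutator T a U) (hxy : (x, y) ∈ T.graph) :
    (a x, a y + U x) ∈ T.graph :=
  isCommutator_iff_mem_graph.1 h hxy

theorem mem_graph_zero (h : IsCommutator T a 0) (hxy : (x, y) ∈ T.graph) :
    (a x, a y) ∈ T.graph :=
  isCommutator_zero_iff_mem_graph.1 h hxy

theorem zero : IsCommutator T 0 0 :=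
  isCommutator_zero_iff_mem_graph.2 fun _ _ _ => T.graph.zero_mem

theorem one : IsCommutator T 1 0 := isCommutator_zero_iff_mem_graph.2 fun _ _ hxy => hxy

theorem add (ha : IsCommutator T a U) (hb : IsCommutator T b V) :
    IsCommutator T (a + b) (U + V) :=
  isCommutator_iff_mem_graph.2 fun x y hxy => by
    have h := T.graph.add_mem (ha.mem_graph hxy) (hb.mem_graph hxy)
    rwa [Prod.mk_add_mk, add_add_add_comm] at h

theorem smul (c : ℂ) (ha : IsCommutator T a U) : IsCommutator T (c • a) (c • U) :=
  isCommutator_iff_mem_graph.2 fun x y hxy => by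
    have h := T.graph.smul_mem c (ha.mem_graph hxy)
    rwa [Prod.smul_mk, smul_add] at h

theorem sum {ι : Type*} (s : Finset ι) {a U : ι → H →L[ℂ] H}
    (h : ∀ i ∈ s, IsCommutator T (a i) (U i)) :
    IsCommutator T (∑ i ∈ s, a i) (∑ i ∈ s, U i) := by
  induction s using Finset.cons_induction with
  | empty => exact zero
  | cons i s hi ih =>
    rw [Finset.sum_cons, Finset.sum_cons]
    exact (h i (Finset.mem_cons_self i s)).add (ih fun j hj => h j (Finset.mem_cons_of_mem hj))

theorem mul (ha : IsCommutator T a U) (hb : IsCommutator T b V) :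
    IsCommutator T (a * b) (U * b + a * V) :=
  isCommutator_iff_mem_graph.2 fun x y hxy => by
    have h := ha.mem_graph (hb.mem_graph hxy)
    rwa [map_add, add_assoc, add_comm (a (V x))] at h

theorem pow (ha : IsCommutator T a 0) (m : ℕ) : IsCommutator T (a ^ m) 0 := by
  induction m with
  | zero => exact one
  | succ m ih => simpa [pow_succ] using ih.mul ha

end IsCommutator

theorem CommutesUpTo.mem_graph {c : ℤ} (h : CommutesUpTo c T a) (hxy : (x, y) ∈ T.graph) :
    (a x, c • a y) ∈ T.graph := by
  obtain ⟨hx, rfl⟩ := mem_graph_iff_exists.1 hxy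
  exact mem_graph_iff_exists.2 (h ⟨x, hx⟩)

theorem CommutesUpTo.isCommutator_zero (h : CommutesUpTo 1 T a) : IsCommutator T a 0 :=
  isCommutator_zero_iff_mem_graph.2 fun _ _ hxy => by simpa only [one_smul] using h.mem_graph hxy

theorem IntertwinesUpTo.mem_graph {c : ℤ} {j : H ≃ₗᵢ⋆[ℂ] H} (h : IntertwinesUpTo c T j)
    (hxy : (x, y) ∈ T.graph) : (j x, c • j y) ∈ T.graph := by
  obtain ⟨hx, rfl⟩ := mem_graph_iff_exists.1 hxy
  exact mem_graph_iff_exists.2 (h ⟨x, hx⟩)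

theorem StronglyCommutes.isCommutator_zero (h : StronglyCommutes S T) {z : ℂ} {R : H →L[ℂ] H}
    (hz : z.im ≠ 0) (hR : IsResolventAt S z R) : IsCommutator T R 0 := fun x => by
  simpa only [sub_eq_zero, zero_apply] using h z R hz hR x

namespace IsResolventAt

variable {z w : ℂ} {R Q : H →L[ℂ] H}

theorem mem_graph (h : IsResolventAt T z R) (y : H) : (R y, y + z • R y) ∈ T.graph :=
  mem_graph_iff_exists.2 ((h.1 y).imp fun _ => sub_eq_iff_eq_add.1)

theorem apply_of_mem_graph (h : IsResolventAt T z R) (hxy : (x, y) ∈ T.graph) :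
    R (y - z • x) = x := by
  obtain ⟨hx, rfl⟩ := mem_graph_iff_exists.1 hxy
  exact h.2 ⟨x, hx⟩

theorem sub_eq_smul_mul (hR : IsResolventAt T z R) (hQ : IsResolventAt T w Q) :
    Q - R = (w - z) • (Q * R) := by
  ext x
  have h := hQ.apply_of_mem_graph (hR.mem_graph x)
  rw [add_sub_assoc, ← sub_smul, map_add, map_smul, ← neg_sub w z, neg_smul] at h
  exact sub_eq_iff_eq_add.2 (eq_add_of_add_neg_eq h |>.trans (add_comm _ _))

end IsResolventAt

end Graph

section Eigenspace

/-- The eigenspace of an unbounded operator `T` for `m`, that is,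
`{x ∈ Dom T | T x = m x}`. -/
def unboundedEigenspace {𝕜 E : Type*} [CommRing 𝕜] [AddCommGroup E] [Module 𝕜 E]
    (T : E →ₗ.[𝕜] E) (m : 𝕜) : Submodule 𝕜 E :=
  T.graph.comap (LinearMap.prod LinearMap.id (m • LinearMap.id))

theorem mem_unboundedEigenspace {𝕜 E : Type*} [CommRing 𝕜] [AddCommGroup E] [Module 𝕜 E]
    {T : E →ₗ.[𝕜] E} {m : 𝕜} {x : E} : x ∈ unboundedEigenspace T m ↔ (x, m • x) ∈ T.graph :=
  Iff.rfl

theorem isClosed_unboundedEigenspace {𝕜 E : Type*} [CommRing 𝕜] [AddCommGroup E] [Module 𝕜 E]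
    [TopologicalSpace E] [ContinuousConstSMul 𝕜 E] {T : E →ₗ.[𝕜] E} (hT : T.IsClosed) (m : 𝕜) :
    IsClosed (unboundedEigenspace T m : Set E) :=
  IsClosed.preimage (f := fun x : E => (x, m • x)) (by fun_prop) hT

variable {H : Type*} [NormedAddCommGroup H] [InnerProductSpace ℂ H]
  {T : H →ₗ.[ℂ] H} {a R : H →L[ℂ] H} {x : H} {m z : ℂ}

theorem IsResolventAt.mem_unboundedEigenspace_iff (h : IsResolventAt T z R) :
    x ∈ unboundedEigenspace T m ↔ (m - z) • R x = x := by
  rw [mem_unboundedEigenspace]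
  constructor
  · intro hx
    rw [← map_smul, sub_smul]
    exact h.apply_of_mem_graph hx
  · intro hx
    have hmem := T.graph.smul_mem (m - z) (h.mem_graph x)
    rwa [Prod.smul_mk, hx, smul_add, smul_comm (m - z) z, hx, ← add_smul, sub_add_cancel] at hmem

theorem IsCommutator.mem_unboundedEigenspace {c : ℂ} (h : IsCommutator T a (c • a))
    (hx : x ∈ unboundedEigenspace T m) : a x ∈ unboundedEigenspace T (m + c) := by
  have hmem := h.mem_graph (x := x) (y := m • x) hx
  rwa [map_smul, smul_apply, ← add_smul] at hmem

theorem IsCommutator.mem_unboundedEigenspace_zero (h : IsCommutator T a 0)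
    (hx : x ∈ unboundedEigenspace T m) : a x ∈ unboundedEigenspace T m := by
  have hmem := h.mem_graph_zero (x := x) (y := m • x) hx
  rwa [map_smul] at hmem

end Eigenspace

section SelfAdjoint

variable {𝕜 E : Type*} [RCLike 𝕜] [NormedAddCommGroup E] [InnerProductSpace 𝕜 E] [CompleteSpace E]
  {T : E →ₗ.[𝕜] E}

theorem isSelfAdjoint_iff_adjoint_graph_eq : IsSelfAdjoint T ↔ T.graph.adjoint = T.graph := by
  have adjoint_graph (hdense : Dense (T.domain : Set E)) : T.adjoint.graph = T.graph.adjoint :=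
    LinearPMap.adjoint_graph_eq_graph_adjoint hdense
  constructor
  · intro h
    rw [← adjoint_graph h.dense_domain, LinearPMap.isSelfAdjoint_def.1 h]
  · intro h
    have hdense : Dense (T.domain : Set E) := by
      rw [Submodule.dense_iff_topologicalClosure_eq_top, Submodule.topologicalClosure_eq_top_iff,
        Submodule.eq_bot_iff]
      intro u hu
      refine T.graph_fst_eq_zero_snd (x := 0) ?_ rfl
      rw [← h, Submodule.mem_adjoint_iff]
      intro x y hxy
      obtain ⟨hx, -⟩ := mem_graph_iff_exists.1 hxy
      rw [inner_zero_right, Submodule.inner_right_of_mem_orthogonal hx hu, sub_zero]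
    exact LinearPMap.isSelfAdjoint_def.2
      (LinearPMap.eq_of_eq_graph ((adjoint_graph hdense).trans h))

theorem mem_graph_iff_inner_eq (hT : IsSelfAdjoint T) {u v : E} :
    (u, v) ∈ T.graph ↔ ∀ x y, (x, y) ∈ T.graph → inner 𝕜 y u = inner 𝕜 x v := by
  rw [← isSelfAdjoint_iff_adjoint_graph_eq.1 hT, Submodule.mem_adjoint_iff,
    isSelfAdjoint_iff_adjoint_graph_eq.1 hT]
  simp only [sub_eq_zero]

theorem inner_eq_inner_of_mem_graph (hT : IsSelfAdjoint T) {x y u v : E}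
    (hxy : (x, y) ∈ T.graph) (huv : (u, v) ∈ T.graph) : inner 𝕜 y u = inner 𝕜 x v :=
  (mem_graph_iff_inner_eq hT).1 huv x y hxy

theorem inner_eq_zero_of_mem_unboundedEigenspace (hT : IsSelfAdjoint T) {m l : 𝕜}
    (hml : starRingEnd 𝕜 m ≠ l) {x y : E} (hx : x ∈ unboundedEigenspace T m)
    (hy : y ∈ unboundedEigenspace T l) : inner 𝕜 x y = 0 := by
  have h := inner_eq_inner_of_mem_graph hT (mem_unboundedEigenspace.1 hx)
    (mem_unboundedEigenspace.1 hy)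
  rw [inner_smul_left, inner_smul_right] at h
  by_contra hxy
  exact hml (mul_right_cancel₀ hxy h)

theorem IsCommutator.adjoint {H : Type*} [NormedAddCommGroup H] [InnerProductSpace ℂ H]
    [CompleteSpace H] {T : H →ₗ.[ℂ] H} (hT : IsSelfAdjoint T) {a S : H →L[ℂ] H}
    (h : IsCommutator T a S) :
    IsCommutator T (ContinuousLinearMap.adjoint a) (-ContinuousLinearMap.adjoint S) := by
  refine isCommutator_iff_mem_graph.2 fun x y hxy =>
    (mem_graph_iff_inner_eq hT).2 fun u v huv => ?_
  have hinner := inner_eq_inner_of_mem_graph hT (h.mem_graph huv) hxy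
  rw [inner_add_left, ← eq_sub_iff_add_eq] at hinner
  simp only [ContinuousLinearMap.adjoint_inner_right, inner_add_right, neg_apply, inner_neg_right,
    hinner, sub_eq_add_neg]

end SelfAdjoint

/-! ### Resolvents and reducing subspaces -/

section Resolvent

variable {H : Type*} [NormedAddCommGroup H] [InnerProductSpace ℂ H] [CompleteSpace H]
  {S T : H →ₗ.[ℂ] H}

theorem abs_im_mul_norm_le (hS : IsSelfAdjoint S) (z : ℂ) {x y : H} (hxy : (x, y) ∈ S.graph) :
    |z.im| * ‖x‖ ≤ ‖y - z • x‖ := by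
  have hreal : (inner ℂ x y).im = 0 := by
    rw [← Complex.conj_eq_iff_im, inner_conj_symm, inner_eq_inner_of_mem_graph hS hxy hxy]
  have him : (inner ℂ x (y - z • x)).im = -(z.im * ‖x‖ ^ 2) := by
    rw [inner_sub_right, inner_smul_right, inner_self_eq_norm_sq_to_K, Complex.sub_im, hreal,
      zero_sub]
    simp [← Complex.ofReal_pow]
  have hle : |z.im| * ‖x‖ ^ 2 ≤ ‖x‖ * ‖y - z • x‖ := by
    have h := (Complex.abs_im_le_norm _).trans (norm_inner_le_norm (𝕜 := ℂ) x (y - z • x))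
    rwa [him, abs_neg, abs_mul, abs_of_nonneg (sq_nonneg ‖x‖)] at h
  rcases (norm_nonneg x).eq_or_lt with hx | hx
  · simp only [← hx, mul_zero, norm_nonneg]
  · exact le_of_mul_le_mul_left (by linarith) hx

/-- The operator `S - z`, as a bounded operator on the graph of `S`. -/
def subSMulOnGraph (S : H →ₗ.[ℂ] H) (z : ℂ) : S.graph →L[ℂ] H :=
  (.snd ℂ H H - z • .fst ℂ H H) ∘L S.graph.subtypeL

theorem topologicalClosure_range_subSMulOnGraph (hS : IsSelfAdjoint S) {z : ℂ} (hz : z.im ≠ 0) :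
    (subSMulOnGraph S z).range.topologicalClosure = ⊤ := by
  rw [Submodule.topologicalClosure_eq_top_iff, Submodule.eq_bot_iff]
  intro u hu
  have hgraph : (u, starRingEnd ℂ z • u) ∈ S.graph :=
    (mem_graph_iff_inner_eq hS).2 fun x y hxy => by
      have h : inner ℂ (y - z • x) u = 0 :=
        Submodule.inner_right_of_mem_orthogonal
          (LinearMap.mem_range_self (subSMulOnGraph S z).toLinearMap ⟨(x, y), hxy⟩) hu
      rwa [inner_sub_left, inner_smul_left, ← inner_smul_right, sub_eq_zero] at h
  have h := abs_im_mul_norm_le hS (starRingEnd ℂ z) hgraph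
  rw [sub_self, norm_zero, Complex.conj_im, abs_neg] at h
  exact norm_le_zero_iff.1 (nonpos_of_mul_nonpos_right h (abs_pos.2 hz))

theorem exists_antilipschitzWith_subSMulOnGraph (hS : IsSelfAdjoint S) {z : ℂ} (hz : z.im ≠ 0) :
    ∃ c, AntilipschitzWith c (subSMulOnGraph S z) := by
  let c : NNReal := ⟨|z.im|⁻¹ + (1 + ‖z‖ * |z.im|⁻¹), by positivity⟩
  refine ⟨c, (subSMulOnGraph S z).antilipschitz_of_bound ?_⟩
  rintro ⟨⟨x, y⟩, hxy⟩
  change max ‖x‖ ‖y‖ ≤ (|z.im|⁻¹ + (1 + ‖z‖ * |z.im|⁻¹)) * ‖y - z • x‖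
  have hx : ‖x‖ ≤ |z.im|⁻¹ * ‖y - z • x‖ :=
    (le_inv_mul_iff₀ (abs_pos.2 hz)).2 (abs_im_mul_norm_le hS z hxy)
  have hy : ‖y‖ ≤ (1 + ‖z‖ * |z.im|⁻¹) * ‖y - z • x‖ := calc
    ‖y‖ = ‖(y - z • x) + z • x‖ := by rw [sub_add_cancel]
    _ ≤ ‖y - z • x‖ + ‖z‖ * ‖x‖ := (norm_add_le _ _).trans_eq (by rw [norm_smul])
    _ ≤ ‖y - z • x‖ + ‖z‖ * (|z.im|⁻¹ * ‖y - z • x‖) := by gcongr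
    _ = (1 + ‖z‖ * |z.im|⁻¹) * ‖y - z • x‖ := by ring
  have := norm_nonneg x
  have := norm_nonneg y
  rw [add_mul]
  exact max_le (by linarith) (by linarith)

theorem exists_isResolventAt (hS : IsSelfAdjoint S) {z : ℂ} (hz : z.im ≠ 0) :
    ∃ R, IsResolventAt S z R := by
  have : CompleteSpace S.graph := hS.isClosed.completeSpace_coe
  have hbij : Function.Bijective (subSMulOnGraph S z) :=
    (subSMulOnGraph S z).bijective_iff_dense_range_and_antilipschitz.2
      ⟨topologicalClosure_range_subSMulOnGraph hS hz, exists_antilipschitzWith_subSMulOnGraph hS hz⟩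
  let e : S.graph ≃L[ℂ] H := .ofBijective (subSMulOnGraph S z) (LinearMap.ker_eq_bot.2 hbij.1)
    (LinearMap.range_eq_top.2 hbij.2)
  refine ⟨.fst ℂ H H ∘L S.graph.subtypeL ∘L e.symm, fun y => ?_, fun x => ?_⟩
  · obtain ⟨hx, hSx⟩ := mem_graph_iff_exists.1 (e.symm y).2
    exact ⟨hx, hSx ▸ e.apply_symm_apply y⟩
  · exact congrArg (fun v => v.1.1) (e.symm_apply_apply ⟨_, S.mem_graph x⟩)

end Resolvent

section MeanErgodic

variable {H : Type*} [NormedAddCommGroup H] [InnerProductSpace ℂ H] [CompleteSpace H]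
  {S T : H →ₗ.[ℂ] H}

/-- The mean ergodic theorem, applied to both entries of the pairs in the graph of `T`. -/
theorem IsCommutator.starProjection_eqLocus_one (hT : T.IsClosed) {U : H →L[ℂ] H}
    (hU : IsCommutator T U 0) (hnorm : ‖U‖ ≤ 1) :
    IsCommutator T (U.eqLocus (1 : H →L[ℂ] H)).starProjection 0 := by
  have haverage (N : ℕ) : IsCommutator T ((N : ℂ)⁻¹ • ∑ j ∈ Finset.range N, U ^ j) 0 := by
    simpa using (IsCommutator.sum _ fun j _ => hU.pow j).smul (N : ℂ)⁻¹
  have hbirkhoff (N : ℕ) (x : H) :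
      birkhoffAverage ℂ U _root_.id N x = ((N : ℂ)⁻¹ • ∑ j ∈ Finset.range N, U ^ j) x := by
    simp [birkhoffAverage, birkhoffSum]
  refine isCommutator_zero_iff_mem_graph.2 fun x y hxy => ?_
  refine hT.mem_of_tendsto
    ((U.tendsto_birkhoffAverage_orthogonalProjection hnorm x).prodMk_nhds
      (U.tendsto_birkhoffAverage_orthogonalProjection hnorm y))
    (Filter.Eventually.of_forall fun N => ?_)
  rw [hbirkhoff, hbirkhoff]
  exact (haverage N).mem_graph_zero hxy

theorem sub_apply_eq_zero_of_inner_nonpos {𝕜 E : Type*} [RCLike 𝕜] [NormedAddCommGroup E]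
    [InnerProductSpace 𝕜 E] {U : E →L[𝕜] E} (hU : ‖U‖ ≤ 1) {x : E}
    (h : RCLike.re (inner 𝕜 x (x - U x)) ≤ 0) : x - U x = 0 := by
  have hUx : ‖U x‖ ≤ ‖x‖ := U.le_of_opNorm_le_of_le hU le_rfl |>.trans_eq (one_mul _)
  have hsq := norm_sub_sq (𝕜 := 𝕜) x (U x)
  rw [inner_sub_right, map_sub, inner_self_eq_norm_sq] at h
  have := pow_le_pow_left₀ (norm_nonneg _) hUx 2
  exact norm_eq_zero.1 (pow_eq_zero_iff two_ne_zero |>.1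
    (le_antisymm (by linarith) (sq_nonneg ‖x - U x‖)))

theorem eqLocus_one_average {𝕜 E ι : Type*} [RCLike 𝕜] [NormedAddCommGroup E]
    [InnerProductSpace 𝕜 E] (s : Finset ι) {U : ι → E →L[𝕜] E} (hU : ∀ j ∈ s, ‖U j‖ ≤ 1) :
    ((s.card + 1 : 𝕜)⁻¹ • (1 + ∑ j ∈ s, U j)).eqLocus (1 : E →L[𝕜] E) =
      ⨅ j ∈ s, (U j).eqLocus (1 : E →L[𝕜] E) := by
  ext x
  have hcard : (s.card + 1 : 𝕜) ≠ 0 := by exact_mod_cast s.card.succ_ne_zero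
  have hiff : x ∈ ((s.card + 1 : 𝕜)⁻¹ • (1 + ∑ j ∈ s, U j)).eqLocus (1 : E →L[𝕜] E) ↔
      ∑ j ∈ s, (x - U j x) = 0 := by
    have h : ((s.card + 1 : 𝕜)⁻¹ • (1 + ∑ j ∈ s, U j)) x = x ↔
        x + ∑ j ∈ s, U j x = (s.card : 𝕜) • x + x := by
      rw [smul_apply, inv_smul_eq_iff₀ hcard, add_smul, one_smul, add_apply, one_apply_eq_self,
        sum_apply]
    refine h.trans ?_
    rw [Finset.sum_sub_distrib, Finset.sum_const, ← Nat.cast_smul_eq_nsmul 𝕜, sub_eq_zero,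
      add_comm x, add_left_inj, eq_comm]
  simp only [hiff, Submodule.mem_iInf]
  refine ⟨fun hsum j hj => ?_, fun h => Finset.sum_eq_zero fun j hj => sub_eq_zero.2 (h j hj).symm⟩
  have hnonneg (i) (hi : i ∈ s) : 0 ≤ RCLike.re (inner 𝕜 x (x - U i x)) := by
    rw [inner_sub_right, map_sub, inner_self_eq_norm_mul_norm, sub_nonneg]
    exact (re_inner_le_norm _ _).trans (mul_le_mul_of_nonneg_left
      (((U i).le_of_opNorm_le_of_le (hU i hi) le_rfl).trans_eq (one_mul _)) (norm_nonneg x))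
  have hzero : ∑ i ∈ s, RCLike.re (inner 𝕜 x (x - U i x)) = 0 := by
    rw [← map_sum, ← inner_sum, hsum, inner_zero_right, map_zero]
  have hj0 := (Finset.sum_eq_zero_iff_of_nonneg hnonneg).1 hzero j hj
  exact (sub_eq_zero.1 (sub_apply_eq_zero_of_inner_nonpos (hU j hj) hj0.le)).symm

theorem norm_average_le {𝕜 E ι : Type*} [RCLike 𝕜] [NormedAddCommGroup E]
    [InnerProductSpace 𝕜 E] (s : Finset ι) {U : ι → E →L[𝕜] E} (hU : ∀ j ∈ s, ‖U j‖ ≤ 1) :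
    ‖(s.card + 1 : 𝕜)⁻¹ • (1 + ∑ j ∈ s, U j)‖ ≤ 1 := by
  have hcard : ‖(s.card + 1 : 𝕜)‖ = s.card + 1 := by
    rw [← Nat.cast_succ, RCLike.norm_natCast, Nat.cast_succ]
  have hsum : ‖∑ j ∈ s, U j‖ ≤ s.card := by
    simpa using norm_sum_le_of_le s hU
  have hone : ‖(1 : E →L[𝕜] E)‖ ≤ 1 := ContinuousLinearMap.norm_id_le
  have hadd := norm_add_le (1 : E →L[𝕜] E) (∑ j ∈ s, U j)
  rw [norm_smul, norm_inv, hcard, inv_mul_le_one₀ (by positivity)]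
  linarith

/-- The eigenspace of `S` for the real number `r` is the fixed space of the contraction
`-i (S - r - i)⁻¹`. -/
theorem exists_eqLocus_one_eq_unboundedEigenspace (hS : IsSelfAdjoint S) (r : ℝ) :
    ∃ U : H →L[ℂ] H, ‖U‖ ≤ 1 ∧ U.eqLocus (1 : H →L[ℂ] H) = unboundedEigenspace S r ∧
      ∀ T, StronglyCommutes S T → IsCommutator T U 0 := by
  obtain ⟨R, hR⟩ := exists_isResolventAt hS (z := r + Complex.I) (by simp)
  refine ⟨-Complex.I • R, ?_, ?_, fun T hST => ?_⟩
  · refine ContinuousLinearMap.opNorm_le_bound _ zero_le_one fun y => ?_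
    have h := abs_im_mul_norm_le hS (r + Complex.I) (hR.mem_graph y)
    simpa [norm_smul] using h
  · ext x
    rw [hR.mem_unboundedEigenspace_iff, sub_add_cancel_left]
    rfl
  · simpa only [smul_zero] using (hST.isCommutator_zero (by simp) hR).smul (-Complex.I)

end MeanErgodic

section ReducingSubspace

variable {H : Type*} [NormedAddCommGroup H] [InnerProductSpace ℂ H] {T : H →ₗ.[ℂ] H}

/-- A closed subspace `K` reduces an unbounded operator `T` if the orthogonal projection onto `K`
preserves the domain of `T` and commutes with `T`. -/
def IsReducing (K : Submodule ℂ H) [K.HasOrthogonalProjection] (T : H →ₗ.[ℂ] H) : Prop :=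
  IsCommutator T K.starProjection 0

namespace IsReducing

variable {K : Submodule ℂ H} [K.HasOrthogonalProjection]

theorem mem_graph (h : IsReducing K T) {x y : H} (hxy : (x, y) ∈ T.graph) :
    (K.starProjection x, K.starProjection y) ∈ T.graph :=
  h.mem_graph_zero hxy

theorem mem_of_mem_graph (h : IsReducing K T) {x y : H} (hx : x ∈ K) (hxy : (x, y) ∈ T.graph) :
    y ∈ K :=
  Submodule.starProjection_eq_self_iff.1
    (T.mem_graph_snd_inj (h.mem_graph hxy) hxy (Submodule.starProjection_eq_self_iff.2 hx))

theorem topologicalClosure_domain_inf (h : IsReducing K T) (hT : Dense (T.domain : Set H)) :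
    (T.domain ⊓ K).topologicalClosure = K := by
  have hK : IsClosed (K : Set H) := K.orthogonal_orthogonal ▸ Kᗮ.isClosed_orthogonal
  refine le_antisymm ((T.domain ⊓ K).topologicalClosure_minimal inf_le_right hK) fun x hx => ?_
  rw [← Submodule.starProjection_eq_self_iff.2 hx]
  refine map_mem_closure K.starProjection.continuous (hT x) fun y hy => ?_
  exact ⟨(mem_graph_iff_exists.1 (h.mem_graph (T.mem_graph ⟨y, hy⟩))).1,
    K.starProjection_apply_mem y⟩

end IsReducing

variable {ι : Type*} {S : ι → H →ₗ.[ℂ] H} {s : Finset ι} {k : ι → ℝ}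

/-- The joint eigenspace `{x | S j x = k j x for all j ∈ s}` of a family of unbounded operators. -/
def jointEigenspace (S : ι → H →ₗ.[ℂ] H) (s : Finset ι) (k : ι → ℝ) : Submodule ℂ H :=
  ⨅ j ∈ s, unboundedEigenspace (S j) (k j)

theorem mem_jointEigenspace {x : H} :
    x ∈ jointEigenspace S s k ↔ ∀ j ∈ s, x ∈ unboundedEigenspace (S j) (k j) := by
  simp only [jointEigenspace, Submodule.mem_iInf]

variable [CompleteSpace H]

theorem isClosed_jointEigenspace (hS : ∀ j ∈ s, IsSelfAdjoint (S j)) :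
    IsClosed (jointEigenspace S s k : Set H) := by
  simp only [jointEigenspace, Submodule.coe_iInf]
  exact isClosed_biInter fun j hj => isClosed_unboundedEigenspace (hS j hj).isClosed _

/-- The joint eigenspace is the fixed space of an average of contractions, each commuting with
`T`. -/
theorem isReducing_jointEigenspace (hS : ∀ j ∈ s, IsSelfAdjoint (S j))
    [(jointEigenspace S s k).HasOrthogonalProjection] (hT : T.IsClosed)
    (hST : ∀ j ∈ s, StronglyCommutes (S j) T) : IsReducing (jointEigenspace S s k) T := by
  choose! U hU_norm hU_fix hU_comm using
    fun j hj => exists_eqLocus_one_eq_unboundedEigenspace (hS j hj) (k j)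
  have hfix : ((s.card + 1 : ℂ)⁻¹ • (1 + ∑ j ∈ s, U j)).eqLocus (1 : H →L[ℂ] H) =
      jointEigenspace S s k := by
    rw [eqLocus_one_average s hU_norm]
    exact iInf_congr fun j => iInf_congr (hU_fix j)
  have hcomm : IsCommutator T ((s.card + 1 : ℂ)⁻¹ • (1 + ∑ j ∈ s, U j)) 0 := by
    have h := IsCommutator.sum s fun j hj => hU_comm j hj T (hST j hj)
    simpa using (IsCommutator.one.add h).smul (s.card + 1 : ℂ)⁻¹
  have h := hcomm.starProjection_eqLocus_one hT (norm_average_le s hU_norm)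
  simp only [hfix] at h
  exact h

end ReducingSubspace

/-! ### Self-adjoint operators with discrete spectrum -/

section IsolatedSpectrum

theorem continuousOn_indicator_singleton {X : Type*} [TopologicalSpace X] [T1Space X] {s : Set X}
    {c : X} (hc : ∀ᶠ t in nhdsWithin c s, t = c) :
    ContinuousOn (Set.indicator {c} (1 : X → ℝ)) s := by
  intro t _
  by_cases h : t = c
  · subst h
    exact tendsto_const_nhds.congr' (hc.mono fun u hu => by rw [hu])
  · have hne : ∀ᶠ u in nhdsWithin t s, u ≠ c := nhdsWithin_le_nhds (isOpen_ne.mem_nhds h)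
    refine Filter.Tendsto.congr' (hne.mono fun u hu => ?_) tendsto_const_nhds
    rw [Set.indicator_of_notMem (by simpa using h), Set.indicator_of_notMem (by simpa using hu)]

theorem eventually_eq_of_finite_le_abs {s : Set ℝ} (hs : ∀ ε > 0, {t ∈ s | ε ≤ |t|}.Finite) {c : ℝ}
    (hc : c ≠ 0) : ∀ᶠ t in nhdsWithin c s, t = c := by
  have hc' : 0 < |c| := abs_pos.2 hc
  have hfar : ∀ᶠ t in nhds c, |c| / 2 ≤ |t| :=
    (continuous_abs.tendsto c).eventually (Ici_mem_nhds (half_lt_self hc'))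
  have hfin := (hs (|c| / 2) (by positivity)).subset (Set.sdiff_subset (t := {c}))
  have hdiff : ∀ᶠ t in nhds c, t ∉ {t ∈ s | |c| / 2 ≤ |t|} \ {c} :=
    hfin.isClosed.isOpen_compl.mem_nhds fun h => h.2 rfl
  filter_upwards [nhdsWithin_le_nhds hfar, nhdsWithin_le_nhds hdiff, self_mem_nhdsWithin]
    with t ht hnot hts
  by_contra hne
  exact hnot ⟨⟨hts, ht⟩, hne⟩

variable {H : Type*} [NormedAddCommGroup H] [InnerProductSpace ℂ H] [CompleteSpace H]
  {R : H →L[ℂ] H}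

theorem mul_cfc_indicator_singleton (hR : IsSelfAdjoint R) {c : ℝ}
    (hc : ∀ᶠ t in nhdsWithin c (spectrum ℝ R), t = c) :
    R * cfc (Set.indicator {c} (1 : ℝ → ℝ)) R = c • cfc (Set.indicator {c} (1 : ℝ → ℝ)) R := by
  have hcont := continuousOn_indicator_singleton hc
  nth_rw 1 [← cfc_id' ℝ R]
  rw [← cfc_mul _ _ R (by fun_prop) hcont, ← cfc_smul _ _ R hcont]
  congr 1
  ext t
  by_cases ht : t = c <;> simp [Set.indicator, ht]

theorem cfc_indicator_singleton_apply_eq_zero (hR : IsSelfAdjoint R) {c : ℝ}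
    (hc : ∀ᶠ t in nhdsWithin c (spectrum ℝ R), t = c) {x : H}
    (hx : ∀ u, R u = c • u → inner ℂ u x = 0) :
    cfc (Set.indicator {c} (1 : ℝ → ℝ)) R x = 0 := by
  set P := cfc (Set.indicator {c} (1 : ℝ → ℝ)) R with hP
  have hidem : P * P = P := by
    rw [hP, ← cfc_mul _ _ R (continuousOn_indicator_singleton hc)
      (continuousOn_indicator_singleton hc)]
    congr 1
    ext t
    by_cases ht : t = c <;> simp [Set.indicator, ht]
  have hsymm := ContinuousLinearMap.isSelfAdjoint_iff_isSymmetric.1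
    (cfc_predicate (p := IsSelfAdjoint) (Set.indicator {c} (1 : ℝ → ℝ)) R)
  have hinner : inner ℂ (P x) (P x) = inner ℂ (P x) x := calc
    inner ℂ (P x) (P x) = inner ℂ ((P * P) x) x := (hsymm (P x) x).symm
    _ = inner ℂ (P x) x := by rw [hidem]
  rw [← inner_self_eq_zero (𝕜 := ℂ), hinner]
  exact hx _ (DFunLike.congr_fun (mul_cfc_indicator_singleton hR hc) x)

theorem norm_sub_sum_smul_cfc_indicator_singleton_le (hR : IsSelfAdjoint R) {F : Finset ℝ}
    (hF : ∀ c ∈ F, ∀ᶠ t in nhdsWithin c (spectrum ℝ R), t = c) {ε : ℝ} (hε : 0 ≤ ε)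
    (hle : ∀ t ∈ spectrum ℝ R, t ∉ F → |t| ≤ ε) :
    ‖R - ∑ c ∈ F, c • cfc (Set.indicator {c} (1 : ℝ → ℝ)) R‖ ≤ ε := by
  have hcont (c) (hc : c ∈ F) :
      ContinuousOn (c • Set.indicator {c} (1 : ℝ → ℝ)) (spectrum ℝ R) :=
    (continuousOn_indicator_singleton (hF c hc)).const_smul c
  have hcfc : cfc (_root_.id - ∑ c ∈ F, c • Set.indicator {c} (1 : ℝ → ℝ)) R =
      R - ∑ c ∈ F, c • cfc (Set.indicator {c} (1 : ℝ → ℝ)) R := by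
    have hsum : ContinuousOn (∑ c ∈ F, c • Set.indicator {c} (1 : ℝ → ℝ)) (spectrum ℝ R) :=
      (continuousOn_finsetSum F hcont).congr fun t _ => Finset.sum_apply t F _
    refine (cfc_sub _ _ R continuousOn_id hsum).trans ?_
    rw [cfc_id ℝ R, cfc_sum _ R F hcont]
    exact congrArg _ (Finset.sum_congr rfl fun c hc =>
      cfc_smul c _ R (continuousOn_indicator_singleton (hF c hc)))
  rw [← hcfc]
  refine norm_cfc_le hε fun t ht => ?_
  by_cases htF : t ∈ F
  · simp [Pi.single_apply, htF, hε]
  · simpa [Pi.single_apply, htF] using hle t ht htF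

/-- `R` differs by at most `ε` from the combination `∑ c P_c` of the eigenprojections for the
finitely many spectral points `c` with `ε ≤ |c|`, all of which kill `x`. -/
theorem apply_eq_zero_of_inner_eigenvector_eq_zero (hR : IsSelfAdjoint R)
    (hfin : ∀ ε > 0, {t ∈ spectrum ℝ R | ε ≤ |t|}.Finite) {x : H}
    (hx : ∀ c : ℝ, c ≠ 0 → ∀ u, R u = c • u → inner ℂ u x = 0) : R x = 0 := by
  suffices hsmall : ∀ ε > 0, ‖R x‖ ≤ ε * ‖x‖ by
    have hlim : Filter.Tendsto (fun ε => ε * ‖x‖) (nhdsWithin 0 (Set.Ioi 0)) (nhds 0) := by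
      have h : Continuous fun ε => ε * ‖x‖ := by fun_prop
      exact (zero_mul ‖x‖ ▸ h.tendsto 0).mono_left nhdsWithin_le_nhds
    exact norm_le_zero_iff.1 (ge_of_tendsto hlim (eventually_mem_nhdsWithin.mono hsmall))
  intro ε hε
  let F := (hfin ε hε).toFinset
  have hF (c) : c ∈ F ↔ c ∈ spectrum ℝ R ∧ ε ≤ |c| := (hfin ε hε).mem_toFinset
  have hne (c) (hc : c ∈ F) : c ≠ 0 := abs_pos.1 (hε.trans_le ((hF c).1 hc).2)
  have hiso (c) (hc : c ∈ F) : ∀ᶠ t in nhdsWithin c (spectrum ℝ R), t = c :=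
    eventually_eq_of_finite_le_abs hfin (hne c hc)
  have happly : (R - ∑ c ∈ F, c • cfc (Set.indicator {c} (1 : ℝ → ℝ)) R) x = R x := by
    rw [sub_apply, sum_apply, Finset.sum_eq_zero, sub_zero]
    intro c hc
    rw [smul_apply, cfc_indicator_singleton_apply_eq_zero hR (hiso c hc) (hx c (hne c hc)),
      smul_zero]
  rw [← happly]
  refine ContinuousLinearMap.le_of_opNorm_le _
    (norm_sub_sum_smul_cfc_indicator_singleton_le hR hiso hε.le fun t ht htF => ?_) x
  exact (not_le.1 fun h => htF ((hF t).2 ⟨ht, h⟩)).le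

end IsolatedSpectrum

section DiscreteSpectrum

variable {H : Type*} [NormedAddCommGroup H] [InnerProductSpace ℂ H] {S : H →ₗ.[ℂ] H}

theorem IsResolventAt.add_inv_mem_unboundedSpectrum {t : ℝ} {R : H →L[ℂ] H}
    (hR : IsResolventAt S t R) {s : ℝ} (hs : s ∈ spectrum ℝ R) (hs0 : s ≠ 0) :
    ((t + s⁻¹ : ℝ) : ℂ) ∈ unboundedSpectrum S := by
  rintro ⟨Q, hQ⟩
  have hsc : (s : ℂ) ≠ 0 := by exact_mod_cast hs0
  have hleft : Q * R = (s : ℂ) • (Q - R) := by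
    rw [hR.sub_eq_smul_mul hQ, smul_smul]
    simp [hsc]
  have hright : R * Q = (s : ℂ) • (Q - R) := by
    rw [← neg_sub, hQ.sub_eq_smul_mul hR, ← neg_smul, smul_smul]
    simp [hsc]
  have hs_eq : algebraMap ℝ (H →L[ℂ] H) s = (s : ℂ) • 1 := by
    rw [Algebra.algebraMap_eq_smul_one, Complex.coe_smul]
  -- From `(t + s⁻¹ - S) Q = -1` one reads off `(s - R)⁻¹ = s⁻¹ + s⁻² Q`.
  refine hs ⟨⟨algebraMap ℝ _ s - R, (s : ℂ)⁻¹ • 1 + ((s : ℂ)⁻¹ * (s : ℂ)⁻¹) • Q, ?_, ?_⟩, rfl⟩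
  · rw [hs_eq]
    simp only [sub_mul, mul_add, smul_mul_assoc, mul_smul_comm, mul_one, one_mul, hright]
    match_scalars <;> field_simp <;> ring
  · rw [hs_eq]
    simp only [mul_sub, add_mul, smul_mul_assoc, mul_smul_comm, mul_one, one_mul, hleft]
    match_scalars <;> field_simp <;> ring

theorem unboundedEigenspace_eq_bot {m : ℂ} (hm : m ∉ unboundedSpectrum S) :
    unboundedEigenspace S m = ⊥ := by
  obtain ⟨R, hR⟩ := not_not.1 hm
  refine (Submodule.eq_bot_iff _).2 fun x hx => ?_
  rw [← hR.mem_unboundedEigenspace_iff.1 hx, sub_self, zero_smul]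

variable [CompleteSpace H]

theorem IsResolventAt.isSelfAdjoint (hS : IsSelfAdjoint S) {t : ℝ} {R : H →L[ℂ] H}
    (hR : IsResolventAt S t R) : IsSelfAdjoint R := by
  rw [ContinuousLinearMap.isSelfAdjoint_iff_isSymmetric]
  intro x y
  have h := inner_eq_inner_of_mem_graph hS (hR.mem_graph x) (hR.mem_graph y)
  rw [inner_add_left, inner_add_right, inner_smul_left, inner_smul_right, Complex.conj_ofReal] at h
  exact (add_right_cancel h).symm

theorem orthogonal_iSup_unboundedEigenspace (hS : IsSelfAdjoint S)
    (hfin : ∀ r, {z ∈ unboundedSpectrum S | ‖z‖ ≤ r}.Finite) :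
    (⨆ m : ℝ, unboundedEigenspace S m)ᗮ = ⊥ := by
  obtain ⟨t, -, ht⟩ : ∃ t ∈ Set.Icc (0 : ℝ) 1, (t : ℂ) ∉ unboundedSpectrum S := by
    by_contra! hall
    refine Set.Icc_infinite (zero_lt_one' ℝ) (Set.Finite.of_finite_image
      ((hfin 1).subset ?_) Complex.ofReal_injective.injOn)
    rintro _ ⟨t, ht, rfl⟩
    exact ⟨hall t ht, by rw [Complex.norm_real, Real.norm_of_nonneg ht.1]; exact ht.2⟩
  obtain ⟨R, hR⟩ := not_not.1 ht
  refine (Submodule.eq_bot_iff _).2 fun x hx => ?_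
  have hRx : R x = 0 := by
    refine apply_eq_zero_of_inner_eigenvector_eq_zero (hR.isSelfAdjoint hS) (fun ε hε => ?_)
      fun c hc u hu => ?_
    · refine Set.Finite.of_finite_image ((hfin (|t| + ε⁻¹)).subset ?_)
        (f := fun s : ℝ => ((t + s⁻¹ : ℝ) : ℂ)) fun s _ s' _ h => ?_
      · rintro _ ⟨s, ⟨hs, hεs⟩, rfl⟩
        refine ⟨hR.add_inv_mem_unboundedSpectrum hs (abs_pos.1 (hε.trans_le hεs)), ?_⟩
        rw [Complex.norm_real, Real.norm_eq_abs]
        refine (abs_add_le _ _).trans ?_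
        rw [abs_inv]
        gcongr
      · exact inv_injective (add_left_cancel (Complex.ofReal_injective h))
    · have hu' : u ∈ unboundedEigenspace S ((t + c⁻¹ : ℝ) : ℂ) := by
        rw [hR.mem_unboundedEigenspace_iff, hu, Complex.ofReal_add, add_sub_cancel_left,
          Complex.coe_smul, smul_smul, inv_mul_cancel₀ hc, one_smul]
      exact Submodule.inner_right_of_mem_orthogonal
        (le_iSup (fun m : ℝ => unboundedEigenspace S m) _ hu') hx
  have hmem := hR.mem_graph x
  rw [hRx] at hmem
  simpa using S.graph_fst_eq_zero_snd hmem rfl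

end DiscreteSpectrum

section JointEigenspace

variable {H ι : Type*} [NormedAddCommGroup H] [InnerProductSpace ℂ H] [CompleteSpace H]
  {S : ι → H →ₗ.[ℂ] H} {s : Finset ι}

theorem inner_eq_zero_of_mem_jointEigenspace (hS : ∀ j ∈ s, IsSelfAdjoint (S j)) {k l : ι → ℝ}
    {j : ι} (hj : j ∈ s) (hkl : k j ≠ l j) {x y : H} (hx : x ∈ jointEigenspace S s k)
    (hy : y ∈ jointEigenspace S s l) : inner ℂ x y = 0 :=
  inner_eq_zero_of_mem_unboundedEigenspace (hS j hj)
    (by rwa [Complex.conj_ofReal, Complex.ofReal_injective.ne_iff])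
    (mem_jointEigenspace.1 hx j hj) (mem_jointEigenspace.1 hy j hj)

open Classical in
/-- For an eigenvector `u` of `S i`, the projection of `u` onto a joint eigenspace of the remaining
operators is a joint eigenvector of the whole family. -/
theorem orthogonal_iSup_jointEigenspace (hS : ∀ j ∈ s, IsSelfAdjoint (S j))
    (hcomm : ∀ i ∈ s, ∀ j ∈ s, StronglyCommutes (S i) (S j))
    (htotal : ∀ j ∈ s, (⨆ m : ℝ, unboundedEigenspace (S j) m)ᗮ = ⊥) :
    (⨆ k, jointEigenspace S s k)ᗮ = ⊥ := by
  induction s using Finset.induction_on with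
  | empty => simp [jointEigenspace]
  | insert i s his ih =>
    rw [Submodule.eq_bot_iff]
    intro x hx
    have hS' (j) (hj : j ∈ s) : IsSelfAdjoint (S j) := hS j (Finset.mem_insert_of_mem hj)
    rw [← Submodule.mem_bot ℂ, ← ih hS'
      (fun a ha b hb => hcomm a (Finset.mem_insert_of_mem ha) b (Finset.mem_insert_of_mem hb))
      fun j hj => htotal j (Finset.mem_insert_of_mem hj), ← Submodule.iInf_orthogonal,
      Submodule.mem_iInf]
    intro k
    have : CompleteSpace (jointEigenspace S s k) := (isClosed_jointEigenspace hS').completeSpace_coe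
    have hreduces : IsReducing (jointEigenspace S s k) (S i) :=
      isReducing_jointEigenspace hS' (hS i (Finset.mem_insert_self i s)).isClosed fun j hj =>
        hcomm j (Finset.mem_insert_of_mem hj) i (Finset.mem_insert_self i s)
    rw [← Submodule.starProjection_apply_eq_zero_iff, ← Submodule.mem_bot ℂ,
      ← htotal i (Finset.mem_insert_self i s), ← Submodule.iInf_orthogonal, Submodule.mem_iInf]
    intro m
    rw [Submodule.mem_orthogonal]
    intro u hu
    rw [← Submodule.inner_starProjection_left_eq_right]
    refine Submodule.inner_right_of_mem_orthogonal
      (Submodule.mem_iSup_of_mem (Function.update k i m) ?_) hx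
    refine mem_jointEigenspace.2 fun j hj => ?_
    rcases Finset.mem_insert.1 hj with rfl | hj
    · rw [Function.update_self]
      exact IsCommutator.mem_unboundedEigenspace_zero hreduces hu
    · rw [Function.update_of_ne (ne_of_mem_of_not_mem hj his)]
      exact mem_jointEigenspace.1 (Submodule.starProjection_apply_mem _ u) j hj

end JointEigenspace

/-! ### Orthogonal sums of unbounded operators -/

section HilbertSum

variable {ι 𝕜 E : Type*} [RCLike 𝕜] [NormedAddCommGroup E] [InnerProductSpace 𝕜 E]
  {K : ι → Submodule 𝕜 E} [∀ i, (K i).HasOrthogonalProjection]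

theorem starProjection_eq_zero_of_mem
    (hK : OrthogonalFamily 𝕜 (fun i => K i) fun i => (K i).subtypeₗᵢ) {i j : ι}
    (hij : i ≠ j) {x : E} (hx : x ∈ K j) : (K i).starProjection x = 0 :=
  (K i).starProjection_apply_eq_zero_iff.2 fun y hy => hK hij ⟨y, hy⟩ ⟨x, hx⟩

variable [CompleteSpace E]

theorem hasSum_starProjection (hK : IsHilbertSum 𝕜 (fun i => K i) fun i => (K i).subtypeₗᵢ)
    (x : E) : HasSum (fun i => (K i).starProjection x) x := by
  let w := hK.linearIsometryEquiv x
  have hw : HasSum (fun i => (w i : E)) x := by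
    simpa [w] using hK.hasSum_linearIsometryEquiv_symm w
  convert hw with i
  have hi : HasSum (fun j => (K i).starProjection (w j)) ((K i).starProjection (w i)) :=
    hasSum_single i fun j hj => starProjection_eq_zero_of_mem hK.OrthogonalFamily hj.symm (w j).2
  exact ((hw.mapL (K i).starProjection).unique hi).trans
    (Submodule.starProjection_eq_self_iff.2 (w i).2)

theorem mem_topologicalClosure_iSup_iff
    (hK : IsHilbertSum 𝕜 (fun i => K i) fun i => (K i).subtypeₗᵢ)
    {G : ι → Submodule 𝕜 (E × E)} (hGK : ∀ i, G i ≤ (K i).prod (K i))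
    (hG : ∀ i, IsClosed (G i : Set (E × E))) {x y : E} :
    (x, y) ∈ (⨆ i, G i).topologicalClosure ↔
      ∀ i, ((K i).starProjection x, (K i).starProjection y) ∈ G i := by
  constructor
  · intro hxy i
    let P : E × E →L[𝕜] E × E := (K i).starProjection.prodMap (K i).starProjection
    suffices h : (⨆ i, G i).topologicalClosure ≤ (G i).comap (P : E × E →ₗ[𝕜] E × E) from h hxy
    refine Submodule.topologicalClosure_minimal _ (iSup_le fun j v hv => ?_)
      ((hG i).preimage P.continuous)
    obtain ⟨hv1, hv2⟩ := hGK j hv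
    change ((K i).starProjection v.1, (K i).starProjection v.2) ∈ G i
    by_cases hij : i = j
    · subst hij
      rwa [Submodule.starProjection_eq_self_iff.2 hv1, Submodule.starProjection_eq_self_iff.2 hv2]
    · rw [starProjection_eq_zero_of_mem hK.OrthogonalFamily hij hv1,
        starProjection_eq_zero_of_mem hK.OrthogonalFamily hij hv2]
      exact (G i).zero_mem
  · intro h
    refine mem_closure_of_tendsto
      (((hasSum_starProjection hK x).prodMk (hasSum_starProjection hK y)))
      (Filter.Eventually.of_forall fun s => ?_)
    exact Submodule.sum_mem _ fun i _ => Submodule.mem_iSup_of_mem i (h i)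

theorem inner_eq_inner_of_starProjection
    (hK : IsHilbertSum 𝕜 (fun i => K i) fun i => (K i).subtypeₗᵢ) {x y u v : E}
    (h : ∀ i, inner 𝕜 ((K i).starProjection y) ((K i).starProjection u) =
      inner 𝕜 ((K i).starProjection x) ((K i).starProjection v)) :
    inner 𝕜 y u = inner 𝕜 x v := by
  have hasSum_inner (a b : E) :
      HasSum (fun i => inner 𝕜 ((K i).starProjection a) ((K i).starProjection b))
        (inner 𝕜 a b) := by
    convert (hasSum_starProjection hK b).mapL (innerSL 𝕜 a) using 2 with i
    · rw [Submodule.inner_starProjection_left_eq_right, innerSL_apply_apply,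
        Submodule.starProjection_eq_self_iff.2 (Submodule.starProjection_apply_mem _ b)]
    · rw [innerSL_apply_apply]
  exact (hasSum_inner y u).unique (by simpa only [h] using hasSum_inner x v)

/-- The algebraic direct sum of a family of unbounded operators, as an operator on the sum of their
domains; it is meaningful when the sum of the graphs is a graph. -/
def algebraicDirectSum (T : ι → E →ₗ.[𝕜] E) : E →ₗ.[𝕜] E :=
  (⨆ i, (T i).graph).toLinearPMap

variable {T : ι → E →ₗ.[𝕜] E}

theorem snd_eq_zero_of_mem_topologicalClosure_iSup_graph
    (hK : IsHilbertSum 𝕜 (fun i => K i) fun i => (K i).subtypeₗᵢ)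
    (hTK : ∀ i, (T i).graph ≤ (K i).prod (K i)) (hT : ∀ i, (T i).IsClosed) :
    ∀ v ∈ (⨆ i, (T i).graph).topologicalClosure, v.1 = 0 → v.2 = 0 := by
  rintro ⟨x, y⟩ hxy (rfl : x = 0)
  have hy (i) : (K i).starProjection y = 0 :=
    (T i).graph_fst_eq_zero_snd ((mem_topologicalClosure_iSup_iff hK hTK hT).1 hxy i) (map_zero _)
  simpa only [hy] using (hasSum_starProjection hK y).unique (by simpa only [hy] using hasSum_zero)

theorem graph_algebraicDirectSum (hK : IsHilbertSum 𝕜 (fun i => K i) fun i => (K i).subtypeₗᵢ)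
    (hTK : ∀ i, (T i).graph ≤ (K i).prod (K i)) (hT : ∀ i, (T i).IsClosed) :
    (algebraicDirectSum T).graph = ⨆ i, (T i).graph :=
  Submodule.toLinearPMap_graph_eq _ fun v hv => snd_eq_zero_of_mem_topologicalClosure_iSup_graph
    hK hTK hT v (Submodule.le_topologicalClosure _ hv)

theorem isClosable_algebraicDirectSum
    (hK : IsHilbertSum 𝕜 (fun i => K i) fun i => (K i).subtypeₗᵢ)
    (hTK : ∀ i, (T i).graph ≤ (K i).prod (K i)) (hT : ∀ i, (T i).IsClosed) :
    (algebraicDirectSum T).IsClosable :=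
  ⟨(⨆ i, (T i).graph).topologicalClosure.toLinearPMap, by
    rw [graph_algebraicDirectSum hK hTK hT]
    exact (Submodule.toLinearPMap_graph_eq _
      (snd_eq_zero_of_mem_topologicalClosure_iSup_graph hK hTK hT)).symm⟩

theorem mem_graph_closure_algebraicDirectSum_iff
    (hK : IsHilbertSum 𝕜 (fun i => K i) fun i => (K i).subtypeₗᵢ)
    (hTK : ∀ i, (T i).graph ≤ (K i).prod (K i)) (hT : ∀ i, (T i).IsClosed) {x y : E} :
    (x, y) ∈ (algebraicDirectSum T).closure.graph ↔
      ∀ i, ((K i).starProjection x, (K i).starProjection y) ∈ (T i).graph := by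
  rw [← (isClosable_algebraicDirectSum hK hTK hT).graph_closure_eq_closure_graph,
    graph_algebraicDirectSum hK hTK hT, mem_topologicalClosure_iSup_iff hK hTK hT]

theorem isSelfAdjoint_closure_algebraicDirectSum
    (hK : IsHilbertSum 𝕜 (fun i => K i) fun i => (K i).subtypeₗᵢ)
    (hTK : ∀ i, (T i).graph ≤ (K i).prod (K i)) (hT : ∀ i, (T i).IsClosed)
    (hadj : ∀ i, (T i).graph.adjoint ⊓ (K i).prod (K i) = (T i).graph) :
    IsSelfAdjoint (algebraicDirectSum T).closure := by
  have mem_iff {x y : E} := mem_graph_closure_algebraicDirectSum_iff hK hTK hT (x := x) (y := y)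
  refine isSelfAdjoint_iff_adjoint_graph_eq.2 (le_antisymm ?_ ?_)
  · rintro ⟨u, v⟩ huv
    refine mem_iff.2 fun i => ?_
    rw [← hadj]
    refine ⟨(Submodule.mem_adjoint_iff _ _).2 fun x y hxy => ?_,
      (K i).starProjection_apply_mem u, (K i).starProjection_apply_mem v⟩
    obtain ⟨hx, hy⟩ := hTK i hxy
    have hle : (T i).graph ≤ (algebraicDirectSum T).closure.graph := by
      rw [← (isClosable_algebraicDirectSum hK hTK hT).graph_closure_eq_closure_graph,
        graph_algebraicDirectSum hK hTK hT]
      exact (le_iSup (fun i => (T i).graph) i).trans (Submodule.le_topologicalClosure _)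
    rw [← Submodule.inner_starProjection_left_eq_right,
      ← Submodule.inner_starProjection_left_eq_right, Submodule.starProjection_eq_self_iff.2 hx,
      Submodule.starProjection_eq_self_iff.2 hy]
    exact (Submodule.mem_adjoint_iff _ _).1 huv x y (hle hxy)
  · rintro ⟨u, v⟩ huv
    refine (Submodule.mem_adjoint_iff _ _).2 fun x y hxy =>
      sub_eq_zero.2 (inner_eq_inner_of_starProjection hK fun i => sub_eq_zero.1 ?_)
    have hi := mem_iff.1 huv i
    rw [← hadj] at hi
    exact (Submodule.mem_adjoint_iff _ _).1 hi.1 _ _ (mem_iff.1 hxy i)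

end HilbertSum

section CommutatorOfClosure

variable {ι H : Type*} [NormedAddCommGroup H] [InnerProductSpace ℂ H] {a U : H →L[ℂ] H}

theorem IsCommutator.closure {T : H →ₗ.[ℂ] H} (hT : T.IsClosable) (h : IsCommutator T a U) :
    IsCommutator T.closure a U := by
  refine isCommutator_iff_mem_graph.2 fun x y hxy => ?_
  rw [← hT.graph_closure_eq_closure_graph] at hxy ⊢
  exact map_mem_closure (f := fun v : H × H => (a v.1, a v.2 + U v.1)) (by fun_prop) hxy
    fun v hv => h.mem_graph hv

theorem isCommutator_algebraicDirectSum {T : ι → H →ₗ.[ℂ] H}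
    (hT : (algebraicDirectSum T).graph = ⨆ i, (T i).graph) (σ : ι → ι)
    (h : ∀ i x y, (x, y) ∈ (T i).graph → (a x, a y + U x) ∈ (T (σ i)).graph) :
    IsCommutator (algebraicDirectSum T) a U := by
  let L : H × H →ₗ[ℂ] H × H := LinearMap.prod ((a : H →ₗ[ℂ] H) ∘ₗ .fst ℂ H H)
    ((a : H →ₗ[ℂ] H) ∘ₗ .snd ℂ H H + (U : H →ₗ[ℂ] H) ∘ₗ .fst ℂ H H)
  have hL : (⨆ i, (T i).graph) ≤ (⨆ i, (T i).graph).comap L :=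
    iSup_le fun i v hv => Submodule.mem_iSup_of_mem (σ i) (h i v.1 v.2 hv)
  rw [← hT] at hL
  exact isCommutator_iff_mem_graph.2 fun _ _ hxy => hL hxy

end CommutatorOfClosure

section PerturbedRestriction

variable {H : Type*} [NormedAddCommGroup H] [InnerProductSpace ℂ H] {T : H →ₗ.[ℂ] H}
  {B : H →L[ℂ] H} {K : Submodule ℂ H} {x y : H}

/-- The restriction of the bounded perturbation `T - B` of an unbounded operator `T` to the
subspace `K`, with domain `Dom T ∩ K`. -/
def subOn (T : H →ₗ.[ℂ] H) (B : H →L[ℂ] H) (K : Submodule ℂ H) : H →ₗ.[ℂ] H :=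
  (-(B : H →ₗ[ℂ] H) +ᵥ T).domRestrict K

theorem mem_graph_subOn : (x, y) ∈ (subOn T B K).graph ↔ x ∈ K ∧ (x, y + B x) ∈ T.graph := by
  rw [mem_graph_iff_exists, mem_graph_iff_exists]
  constructor
  · rintro ⟨hx, rfl⟩
    exact ⟨hx.1, hx.2, (neg_add_cancel_comm (B x) (T ⟨x, hx.2⟩)).symm⟩
  · rintro ⟨hxK, hx, hTx⟩
    exact ⟨⟨hxK, hx⟩, neg_add_eq_of_eq_add (hTx.trans (add_comm y (B x)))⟩

theorem isClosed_subOn (hT : T.IsClosed) (hK : IsClosed (K : Set H)) : (subOn T B K).IsClosed := by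
  have h : ((subOn T B K).graph : Set (H × H)) =
      Prod.fst ⁻¹' K ∩ (fun v : H × H => (v.1, v.2 + B v.1)) ⁻¹' T.graph :=
    Set.ext fun _ => mem_graph_subOn
  change IsClosed ((subOn T B K).graph : Set (H × H))
  rw [h]
  exact (hK.preimage continuous_fst).inter (IsClosed.preimage (by fun_prop) hT)

variable [K.HasOrthogonalProjection]

theorem graph_subOn_le_prod (hTK : IsReducing K T) (hBK : ∀ x ∈ K, B x ∈ K) :
    (subOn T B K).graph ≤ K.prod K := by
  rintro ⟨x, y⟩ hxy
  obtain ⟨hx, hxy⟩ := mem_graph_subOn.1 hxy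
  exact ⟨hx, (K.add_mem_iff_left (hBK x hx)).1 (hTK.mem_of_mem_graph hx hxy)⟩

theorem topologicalClosure_domain_subOn (hTK : IsReducing K T)
    (hT : Dense (T.domain : Set H)) : (subOn T B K).domain.topologicalClosure = K := by
  have h : (subOn T B K).domain = T.domain ⊓ K := inf_comm _ _
  rw [h, hTK.topologicalClosure_domain_inf hT]

theorem adjoint_graph_subOn_inf_prod [CompleteSpace H] (hT : IsSelfAdjoint T)
    (hB : IsSelfAdjoint B) (hTK : IsReducing K T) (hBK : ∀ x ∈ K, B x ∈ K) :
    (subOn T B K).graph.adjoint ⊓ K.prod K = (subOn T B K).graph := by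
  have hsymm (x y : H) : inner ℂ (B x) y = inner ℂ x (B y) :=
    ContinuousLinearMap.isSelfAdjoint_iff_isSymmetric.1 hB x y
  refine le_antisymm ?_ (le_inf ?_ (graph_subOn_le_prod hTK hBK))
  · rintro ⟨u, v⟩ ⟨huv, hu, hv⟩
    refine mem_graph_subOn.2 ⟨hu, (mem_graph_iff_inner_eq hT).2 fun x y hxy => ?_⟩
    have hP : (K.starProjection x, K.starProjection y - B (K.starProjection x)) ∈
        (subOn T B K).graph :=
      mem_graph_subOn.2 ⟨K.starProjection_apply_mem x, by simpa using hTK.mem_graph hxy⟩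
    have h := sub_eq_zero.1 ((Submodule.mem_adjoint_iff _ _).1 huv _ _ hP)
    rwa [inner_sub_left, hsymm, sub_eq_iff_eq_add, ← inner_add_right,
      Submodule.inner_starProjection_left_eq_right, Submodule.inner_starProjection_left_eq_right,
      Submodule.starProjection_eq_self_iff.2 hu,
      Submodule.starProjection_eq_self_iff.2 (K.add_mem hv (hBK u hu))] at h
  · rintro ⟨u, v⟩ huv
    refine (Submodule.mem_adjoint_iff _ _).2 fun x y hxy => ?_
    have h := inner_eq_inner_of_mem_graph hT (mem_graph_subOn.1 hxy).2 (mem_graph_subOn.1 huv).2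
    rw [inner_add_left, inner_add_right, hsymm] at h
    exact sub_eq_zero.2 (add_right_cancel h)

end PerturbedRestriction

/-! ### Homogeneous components in a comodule algebra of the torus -/

section TorusHopf

variable {n : ℕ}

/-- The functional of `H(𝕋ⁿ)` that reads off the coefficient of `z^k`. -/
def torusCoeff (k : Fin n → ℤ) : TorusHopf n →ₗ[ℂ] ℂ :=
  Finsupp.lapply k ∘ₗ (AddMonoidAlgebra.coeffLinearEquiv ℂ).toLinearMap

theorem torusCoeff_torusMonomial [DecidableEq (Fin n → ℤ)] (k l : Fin n → ℤ) :
    torusCoeff k (torusMonomial l) = if l = k then 1 else 0 :=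
  Finsupp.single_apply

theorem torusLieGenerator_torusMonomial (j : Fin n) (k : Fin n → ℤ) :
    torusLieGenerator j (torusMonomial k) = (k j : ℂ) := by
  simp [torusLieGenerator, torusMonomial]

theorem comul_torusMonomial (k : Fin n → ℤ) :
    Coalgebra.comul (R := ℂ) (torusMonomial k) = torusMonomial k ⊗ₜ[ℂ] torusMonomial k := by
  simp [torusMonomial]

theorem counit_torusMonomial (k : Fin n → ℤ) :
    Coalgebra.counit (R := ℂ) (torusMonomial k) = 1 := by
  simp [torusMonomial]

theorem antipode_torusMonomial (k : Fin n → ℤ) :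
    HopfAlgebra.antipode ℂ (torusMonomial k) = torusMonomial (-k) := by
  simp [torusMonomial]

theorem torusHopf_hom_ext {M : Type*} [AddCommMonoid M] [Module ℂ M] {f g : TorusHopf n →ₗ[ℂ] M}
    (h : ∀ k, f (torusMonomial k) = g (torusMonomial k)) : f = g :=
  AddMonoidAlgebra.lhom_ext' fun k => LinearMap.ext_ring (h k)

variable (M : Type*) [AddCommMonoid M] [Module ℂ M]

/-- The map `m ⊗ z^l ↦ δ_{kl} m` that reads off the coefficient of `z^k` in `M ⊗ H(𝕋ⁿ)`. -/
def tensorCoeff (k : Fin n → ℤ) : M ⊗[ℂ] TorusHopf n →ₗ[ℂ] M :=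
  (TensorProduct.rid ℂ M).toLinearMap ∘ₗ (torusCoeff k).lTensor M

variable {M}

theorem tensorCoeff_tmul (k : Fin n → ℤ) (m : M) (h : TorusHopf n) :
    tensorCoeff M k (m ⊗ₜ h) = torusCoeff k h • m := by
  simp [tensorCoeff]

theorem tensorCoeff_tmul_torusMonomial (k : Fin n → ℤ) (m : M) :
    tensorCoeff M k (m ⊗ₜ torusMonomial k) = m := by
  classical
  simp [tensorCoeff_tmul, torusCoeff_torusMonomial]

theorem tensorCoeff_rTensor {N : Type*} [AddCommMonoid N] [Module ℂ N] (f : M →ₗ[ℂ] N)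
    (k : Fin n → ℤ) (t : M ⊗[ℂ] TorusHopf n) :
    tensorCoeff N k (f.rTensor _ t) = f (tensorCoeff M k t) := by
  induction t with
  | zero => simp
  | add x y hx hy => simp only [map_add, hx, hy]
  | tmul m h => simp [tensorCoeff_tmul]

theorem tensorCoeff_assoc_symm_comul (k : Fin n → ℤ) (t : M ⊗[ℂ] TorusHopf n) :
    tensorCoeff (M ⊗[ℂ] TorusHopf n) k ((TensorProduct.assoc ℂ M _ _).symm
        ((Coalgebra.comul (R := ℂ) (A := TorusHopf n)).lTensor M t)) =
      tensorCoeff M k t ⊗ₜ torusMonomial k := by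
  classical
  suffices h : tensorCoeff (M ⊗[ℂ] TorusHopf n) k ∘ₗ
      (TensorProduct.assoc ℂ M _ _).symm.toLinearMap ∘ₗ
        (Coalgebra.comul (R := ℂ) (A := TorusHopf n)).lTensor M =
      (TensorProduct.mk ℂ M (TorusHopf n)).flip (torusMonomial k) ∘ₗ tensorCoeff M k from
    LinearMap.congr_fun h t
  refine TensorProduct.ext (LinearMap.ext fun m => torusHopf_hom_ext fun l => ?_)
  obtain rfl | hl := eq_or_ne l k <;>
    simp [comul_torusMonomial, tensorCoeff_tmul, torusCoeff_torusMonomial, *]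

theorem exists_sum_tmul_torusMonomial (t : M ⊗[ℂ] TorusHopf n) :
    ∃ b : (Fin n → ℤ) →₀ M, (b.sum fun k m => m ⊗ₜ torusMonomial k) = t :=
  TensorProduct.eq_repr_basis_right (.ofRepr (AddMonoidAlgebra.coeffLinearEquiv ℂ)) t

theorem tensorCoeff_sum_tmul_torusMonomial (b : (Fin n → ℤ) →₀ M) (k : Fin n → ℤ) :
    tensorCoeff M k (b.sum fun l m => m ⊗ₜ torusMonomial l) = b k := by
  classical
  simp +contextual [Finsupp.sum, tensorCoeff_tmul, torusCoeff_torusMonomial]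

end TorusHopf

namespace TorusComoduleAlgebra

variable {n : ℕ} {A : Type*} [Ring A] [Algebra ℂ A] (C : TorusComoduleAlgebra n A)
  {k : Fin n → ℤ} {a : A}

theorem mem_homogeneous : a ∈ C.homogeneous k ↔ C.coact a = a ⊗ₜ[ℂ] torusMonomial k := Iff.rfl

theorem deriv_of_mem_homogeneous (ha : a ∈ C.homogeneous k) (j : Fin n) :
    C.deriv j a = (k j : ℂ) • a := by
  simp [deriv, C.mem_homogeneous.1 ha, torusLieGenerator_torusMonomial]

/-- The projection of `A` onto `A^(k)`. -/
def component (k : Fin n → ℤ) : A →ₗ[ℂ] A := tensorCoeff A k ∘ₗ C.coact.toLinearMap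

theorem component_mem_homogeneous (k : Fin n → ℤ) (a : A) : C.component k a ∈ C.homogeneous k := by
  have hcoassoc : C.coact.toLinearMap.rTensor (TorusHopf n) (C.coact a) =
      (TensorProduct.assoc ℂ A _ _).symm
        ((Coalgebra.comul (R := ℂ) (A := TorusHopf n)).lTensor A (C.coact a)) :=
    (LinearEquiv.eq_symm_apply _).2 (LinearMap.congr_fun C.coassoc a)
  calc C.coact (tensorCoeff A k (C.coact a))
      = tensorCoeff _ k (C.coact.toLinearMap.rTensor (TorusHopf n) (C.coact a)) :=
        (tensorCoeff_rTensor C.coact.toLinearMap k _).symm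
    _ = tensorCoeff A k (C.coact a) ⊗ₜ torusMonomial k := by
        rw [hcoassoc, tensorCoeff_assoc_symm_comul]

theorem mem_iSup_homogeneous (a : A) : a ∈ ⨆ k, C.homogeneous k := by
  obtain ⟨b, hb⟩ := exists_sum_tmul_torusMonomial (C.coact a)
  have hmem (k) : b k ∈ C.homogeneous k := by
    simpa only [component, LinearMap.comp_apply, AlgHom.toLinearMap_apply, ← hb,
      tensorCoeff_sum_tmul_torusMonomial] using C.component_mem_homogeneous k a
  have hsum : b.sum (fun _ m => m) = a := by
    simpa [← hb, Finsupp.sum, counit_torusMonomial] using LinearMap.congr_fun C.counit a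
  rw [← hsum]
  exact Submodule.sum_mem _ fun k _ => Submodule.mem_iSup_of_mem k (hmem k)

theorem lTensor_component_eq_self {M : Type*} [AddCommMonoid M] [Module ℂ M] {t : M ⊗[ℂ] A}
    (ht : TensorProduct.assoc ℂ M A (TorusHopf n) (t ⊗ₜ torusMonomial k) =
      C.coact.toLinearMap.lTensor M t) :
    (C.component k).lTensor M t = t := by
  have hassoc (t : M ⊗[ℂ] A) : (tensorCoeff A k).lTensor M
      (TensorProduct.assoc ℂ M A (TorusHopf n) (t ⊗ₜ torusMonomial k)) = t := by
    induction t with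
    | zero => simp
    | add x y hx hy => simp only [map_add, TensorProduct.add_tmul, hx, hy]
    | tmul m a => simp [tensorCoeff_tmul_torusMonomial]
  rw [component, LinearMap.lTensor_comp_apply, ← ht, hassoc]

theorem rTensor_component_eq_self {M : Type*} [AddCommMonoid M] [Module ℂ M] {t : A ⊗[ℂ] M}
    (ht : torusMonomial k ⊗ₜ t = TensorProduct.assoc ℂ (TorusHopf n) A M
      ((TensorProduct.comm ℂ A (TorusHopf n)).toLinearMap.rTensor M
        (C.coact.toLinearMap.rTensor M t))) :
    (C.component k).rTensor M t = t := by
  have hcomm (u : (A ⊗[ℂ] TorusHopf n) ⊗[ℂ] M) : (tensorCoeff A k).rTensor M u =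
      TensorProduct.lid ℂ _ ((torusCoeff k).rTensor (A ⊗[ℂ] M)
        (TensorProduct.assoc ℂ (TorusHopf n) A M
          ((TensorProduct.comm ℂ A (TorusHopf n)).toLinearMap.rTensor M u))) := by
    refine LinearMap.congr_fun (g := (TensorProduct.lid ℂ _).toLinearMap ∘ₗ
      (torusCoeff k).rTensor (A ⊗[ℂ] M) ∘ₗ (TensorProduct.assoc ℂ (TorusHopf n) A M).toLinearMap ∘ₗ
        (TensorProduct.comm ℂ A (TorusHopf n)).toLinearMap.rTensor M) ?_ u
    refine TensorProduct.ext_threefold fun a h m => ?_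
    simp [tensorCoeff_tmul, TensorProduct.smul_tmul']
  classical
  rw [component, LinearMap.rTensor_comp_apply, hcomm, ← ht]
  simp [torusCoeff_torusMonomial]

/-- The component of degree `k` of a principal map `ℓ` is supported on `A^(-k) ⊗ A^(k)` by its
two equivariance properties, and multiplication sends it to `ε(z^k) = 1`. -/
theorem IsPrincipal.one_mem_mul {C : TorusComoduleAlgebra n A} (hC : C.IsPrincipal)
    (k : Fin n → ℤ) : (1 : A) ∈ C.homogeneous (-k) * C.homogeneous k := by
  obtain ⟨l, -, hmul, hright, hleft⟩ := hC
  set w := l (torusMonomial k)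
  have hw_right : (C.component k).lTensor A w = w := C.lTensor_component_eq_self <| by
    simpa [comul_torusMonomial] using LinearMap.congr_fun hright (torusMonomial k)
  have hw_left : (C.component (-k)).rTensor A w = w := C.rTensor_component_eq_self <| by
    simpa [comul_torusMonomial, antipode_torusMonomial] using
      LinearMap.congr_fun hleft (torusMonomial k)
  have hmem (t : A ⊗[ℂ] A) : LinearMap.mul' ℂ A
      ((C.component (-k)).rTensor A ((C.component k).lTensor A t)) ∈
        C.homogeneous (-k) * C.homogeneous k := by
    induction t with
    | zero => simp
    | add x y hx hy => simpa only [map_add] using add_mem hx hy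
    | tmul a b =>
      exact Submodule.mul_mem_mul (C.component_mem_homogeneous (-k) a)
        (C.component_mem_homogeneous k b)
  have hw := hmem w
  rwa [hw_right, hw_left, hmul, counit_torusMonomial, map_one] at hw

end TorusComoduleAlgebra

/-! ### Conjugation by the real structure -/

section ConjAdjoint

variable {H : Type*} [NormedAddCommGroup H] [InnerProductSpace ℂ H] (J : H ≃ₗᵢ⋆[ℂ] H)

theorem inner_antiunitary_map_map (x y : H) : inner ℂ (J x) (J y) = inner ℂ y x := by
  have hI (u : H) : Complex.I • J u = -J (Complex.I • u) := by
    rw [map_smulₛₗ, Complex.conj_I, neg_smul, neg_neg]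
  rw [← inner_conj_symm y x, inner_eq_sum_norm_sq_div_four (J x) (J y),
    inner_eq_sum_norm_sq_div_four x y]
  simp only [RCLike.I_to_complex, hI, sub_neg_eq_add, ← sub_eq_add_neg (J x), ← map_add J,
    ← map_sub J, LinearIsometryEquiv.norm_map]
  have conj_four : (starRingEnd ℂ) 4 = 4 := map_ofNat _ 4
  simp only [Complex.coe_algebraMap, map_div₀, map_add, map_sub, map_pow, map_mul, conj_four,
    Complex.conj_ofReal, Complex.conj_I]
  ring

theorem symm_apply_of_sq {J : H ≃ₗᵢ⋆[ℂ] H} {e : ℤ} (hJ : ∀ x, J (J x) = e • x) (he : e * e = 1)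
    (x : H) : J.symm x = e • J x := by
  rw [LinearIsometryEquiv.symm_apply_eq, map_zsmul, hJ, smul_smul, he, one_smul]

variable [CompleteSpace H]

theorem conjAdjoint_apply (X : H →L[ℂ] H) (x : H) :
    conjAdjoint J X x = J (ContinuousLinearMap.adjoint X (J.symm x)) := rfl

theorem conjAdjoint_zero : conjAdjoint J 0 = 0 := by
  ext x
  simp [conjAdjoint_apply]

theorem conjAdjoint_add (X Y : H →L[ℂ] H) :
    conjAdjoint J (X + Y) = conjAdjoint J X + conjAdjoint J Y := by
  ext x
  simp [conjAdjoint_apply]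

theorem conjAdjoint_smul (c : ℂ) (X : H →L[ℂ] H) :
    conjAdjoint J (c • X) = c • conjAdjoint J X := by
  ext x
  simp [conjAdjoint_apply, map_smulₛₗ]

theorem conjAdjoint_one : conjAdjoint J 1 = 1 := by
  ext x
  simp [conjAdjoint_apply, ← ContinuousLinearMap.star_eq_adjoint]

theorem conjAdjoint_mul (X Y : H →L[ℂ] H) :
    conjAdjoint J (X * Y) = conjAdjoint J Y * conjAdjoint J X := by
  ext x
  simp [conjAdjoint_apply, ← ContinuousLinearMap.star_eq_adjoint]

theorem adjoint_conjAdjoint (X : H →L[ℂ] H) :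
    ContinuousLinearMap.adjoint (conjAdjoint J X) =
      conjAdjoint J (ContinuousLinearMap.adjoint X) := by
  refine ((ContinuousLinearMap.eq_adjoint_iff _ _).2 fun x y => ?_).symm
  obtain ⟨x, rfl⟩ := J.surjective x
  obtain ⟨y, rfl⟩ := J.surjective y
  simp [conjAdjoint_apply, inner_antiunitary_map_map, ContinuousLinearMap.adjoint_inner_left]

variable {J}

theorem isSelfAdjoint_conjAdjoint {X : H →L[ℂ] H} (hX : IsSelfAdjoint X) :
    IsSelfAdjoint (conjAdjoint J X) := by
  rw [ContinuousLinearMap.isSelfAdjoint_iff'] at hX ⊢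
  rw [adjoint_conjAdjoint, hX]

theorem commute_conjAdjoint {X Y : H →L[ℂ] H} (h : Commute X Y) :
    Commute (conjAdjoint J X) (conjAdjoint J Y) := by
  rw [commute_iff_eq, ← conjAdjoint_mul, ← conjAdjoint_mul, h.eq]

variable {e : ℤ}

theorem conjAdjoint_conjAdjoint (hJ : ∀ x, J (J x) = e • x) (he : e * e = 1) (X : H →L[ℂ] H) :
    conjAdjoint J (conjAdjoint J X) = X := by
  ext x
  rw [conjAdjoint_apply, adjoint_conjAdjoint, conjAdjoint_apply,
    ContinuousLinearMap.adjoint_adjoint, hJ, symm_apply_of_sq hJ he (J.symm x),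
    LinearIsometryEquiv.apply_symm_apply, map_zsmul, smul_smul, he, one_smul]

theorem IsCommutator.conjAdjoint {T : H →ₗ.[ℂ] H} (hT : IsSelfAdjoint T) {b S : H →L[ℂ] H}
    (h : IsCommutator T b S) {c : ℤ} (hc : c * c = 1) (hJT : IntertwinesUpTo c T J)
    (hJ : ∀ x, J (J x) = e • x) (he : e * e = 1) :
    IsCommutator T (conjAdjoint J b) (-c • conjAdjoint J S) := by
  rw [isCommutator_iff_mem_graph]
  intro x y hxy
  have hsymm : (J.symm x, c • J.symm y) ∈ T.graph := by
    simpa only [symm_apply_of_sq hJ he, Prod.smul_mk, smul_comm e c] using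
      zsmul_mem (hJT.mem_graph hxy) e
  have hmem := hJT.mem_graph ((h.adjoint hT).mem_graph hsymm)
  simpa [conjAdjoint_apply, smul_smul, hc] using hmem

end ConjAdjoint

theorem krEps_mul_self (d : ℕ) : krEps d * krEps d = 1 := by
  unfold krEps
  split_ifs <;> norm_num

theorem krEps'_mul_self (d : ℕ) : krEps' d * krEps' d = 1 := by
  unfold krEps'
  split_ifs <;> norm_num

/-! ### The right action and the weight spaces of an equivariant spectral triple -/

namespace RealSpectralTriple

variable {A : Type*} [Ring A] [StarRing A] [Algebra ℂ A] [StarModule ℂ A]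
  {H : Type*} [NormedAddCommGroup H] [InnerProductSpace ℂ H] [CompleteSpace H] {d : ℕ}
  (T : RealSpectralTriple A H d)

theorem isCommutator_diff (a : A) : IsCommutator T.D (T.π a) (T.diff a) := by
  have h := T.bounded_commutator a
  rw [diff, boundedCommutator, dif_pos h]
  exact h.choose_spec

theorem rightMul_one : T.rightMul 1 = 1 := by rw [rightMul, map_one, conjAdjoint_one]

theorem rightMul_add (a b : A) : T.rightMul (a + b) = T.rightMul a + T.rightMul b := by
  rw [rightMul, map_add, conjAdjoint_add, rightMul, rightMul]

theorem rightMul_mul (a b : A) : T.rightMul (a * b) = T.rightMul b * T.rightMul a := by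
  rw [rightMul, map_mul, conjAdjoint_mul, rightMul, rightMul]

theorem isCommutator_rightMul (p : A) :
    IsCommutator T.D (T.rightMul p) (T.rightForm (T.diff p)) :=
  (T.isCommutator_diff p).conjAdjoint T.selfAdjoint (krEps'_mul_self d) T.J_D T.J_sq
    (krEps_mul_self d)

theorem rightForm_zero : T.rightForm 0 = 0 := by rw [rightForm, conjAdjoint_zero, smul_zero]

theorem rightForm_add (η ζ : H →L[ℂ] H) :
    T.rightForm (η + ζ) = T.rightForm η + T.rightForm ζ := by
  rw [rightForm, conjAdjoint_add, smul_add, rightForm, rightForm]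

theorem rightForm_smul (c : ℂ) (η : H →L[ℂ] H) : T.rightForm (c • η) = c • T.rightForm η := by
  rw [rightForm, conjAdjoint_smul, smul_comm, rightForm]

theorem rightForm_mul (p : A) (η : H →L[ℂ] H) :
    T.rightForm (T.π p * η) = T.rightForm η * T.rightMul p := by
  rw [rightForm, conjAdjoint_mul, rightForm, rightMul, smul_mul_assoc]

theorem isSelfAdjoint_rightForm {η : H →L[ℂ] H} (h : IsSelfAdjoint η) :
    IsSelfAdjoint (T.rightForm η) := by
  rw [rightForm, isSelfAdjoint_iff, star_zsmul, (isSelfAdjoint_conjAdjoint h).star_eq]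

theorem commute_rightForm {η : H →L[ℂ] H} (hη : η ∈ T.oneForms ⊤) (a : A) :
    Commute (T.rightForm η) (T.π a) := by
  have commute_diff (b : A) : Commute (conjAdjoint T.J (T.diff b)) (T.π a) := by
    have h := commute_conjAdjoint (J := T.J) (T.first_order b a)
    rwa [conjAdjoint_conjAdjoint T.J_sq (krEps_mul_self d)] at h
  induction hη using Submodule.span_induction with
  | mem η hη =>
    obtain ⟨b, -, c, -, rfl⟩ := hη
    rw [rightForm_mul]
    exact ((commute_diff c).smul_left _).mul_left (T.commutant a b).symm
  | zero => rw [rightForm_zero]; exact .zero_left _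
  | add η ζ _ _ hη hζ => rw [rightForm_add]; exact hη.add_left hζ
  | smul c η _ hη => rw [rightForm_smul]; exact hη.smul_left c

theorem mem_of_forall_rightMul_mem {n : ℕ} {C : TorusComoduleAlgebra n A} (hC : C.IsPrincipal)
    (k : Fin n → ℤ) {K : Submodule ℂ H} {x : H}
    (h : ∀ a ∈ C.homogeneous (-k), ∀ b ∈ C.homogeneous k, T.rightMul b (T.rightMul a x) ∈ K) :
    x ∈ K := by
  have rightMul_mem (c : A) (hc : c ∈ C.homogeneous (-k) * C.homogeneous k) :
      T.rightMul c x ∈ K := by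
    induction hc using Submodule.mul_induction_on' with
    | mem_mul_mem a ha b hb =>
      rw [rightMul_mul]
      exact h a ha b hb
    | add b _ c _ hb hc =>
      rw [rightMul_add]
      exact K.add_mem hb hc
  simpa only [rightMul_one, one_apply_eq_self] using rightMul_mem 1 (hC.one_mem_mul k)

theorem mem_horizontalDirac_graph {T : RealSpectralTriple A H d} {n : ℕ} {Γ : H →L[ℂ] H}
    {x y : H} :
    (x, y) ∈ (T.horizontalDirac n Γ).graph ↔ ∃ u v, (x, u) ∈ T.D.graph ∧ (Γ x, v) ∈ T.D.graph ∧
      y = (1 / 2 : ℂ) • Γ (Γ u + (-1 : ℂ) ^ n • v) := by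
  rw [mem_graph_iff_exists]
  constructor
  · rintro ⟨h, rfl⟩
    exact ⟨_, _, T.D.mem_graph ⟨x, h.1⟩, T.D.mem_graph ⟨Γ x, h.2⟩, rfl⟩
  · rintro ⟨u, v, hu, hv, rfl⟩
    obtain ⟨hx, rfl⟩ := mem_graph_iff_exists.1 hu
    obtain ⟨hΓx, rfl⟩ := mem_graph_iff_exists.1 hv
    exact ⟨⟨hx, hΓx⟩, rfl⟩

namespace TorusEquivariance

variable {T} {n : ℕ} {C : TorusComoduleAlgebra n A} (E : T.TorusEquivariance C) {k l : Fin n → ℤ}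
  {x y : H}

theorem mem_weightSpace :
    x ∈ E.weightSpace k ↔ ∀ j, x ∈ unboundedEigenspace (E.δ j) (k j) :=
  Submodule.mem_iInf _

theorem jointEigenspace_eq_weightSpace (k : Fin n → ℤ) :
    jointEigenspace E.δ Finset.univ (fun j => (k j : ℝ)) = E.weightSpace k := by
  ext x
  simp only [mem_jointEigenspace, mem_weightSpace, Finset.mem_univ, true_imp_iff,
    Complex.ofReal_intCast]

theorem isClosed_weightSpace (k : Fin n → ℤ) : IsClosed (E.weightSpace k : Set H) := by
  rw [← jointEigenspace_eq_weightSpace]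
  exact isClosed_jointEigenspace fun j _ => E.selfAdjoint j

instance completeSpace_weightSpace (k : Fin n → ℤ) : CompleteSpace (E.weightSpace k) :=
  (E.isClosed_weightSpace k).completeSpace_coe

theorem isReducing_weightSpace (k : Fin n → ℤ) : IsReducing (E.weightSpace k) T.D := by
  have : (jointEigenspace E.δ Finset.univ fun j => (k j : ℝ)).HasOrthogonalProjection := by
    rw [jointEigenspace_eq_weightSpace]
    infer_instance
  simpa only [jointEigenspace_eq_weightSpace] using isReducing_jointEigenspace
    (k := fun j => (k j : ℝ)) (fun j _ => E.selfAdjoint j) T.selfAdjoint.isClosed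
    fun j (_ : j ∈ Finset.univ) => E.commute_D j

theorem orthogonalFamily_weightSpace : OrthogonalFamily ℂ (fun k => E.weightSpace k)
    fun k => (E.weightSpace k).subtypeₗᵢ := by
  rintro k l hkl ⟨x, hx⟩ ⟨y, hy⟩
  obtain ⟨j, hj⟩ := Function.ne_iff.1 hkl
  rw [← jointEigenspace_eq_weightSpace] at hx hy
  exact inner_eq_zero_of_mem_jointEigenspace (fun j _ => E.selfAdjoint j) (Finset.mem_univ j)
    (Int.cast_injective.ne hj) hx hy

theorem finite_spectrum_inter_closedBall (j : Fin n) (r : ℝ) :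
    {z ∈ unboundedSpectrum (E.δ j) | ‖z‖ ≤ r}.Finite := by
  rw [E.spectrum_eq]
  refine ((isCompact_closedBall (0 : ℤ) r).finite_of_discrete.image ((↑) : ℤ → ℂ)).subset ?_
  rintro _ ⟨⟨m, rfl⟩, hm⟩
  exact ⟨m, by simpa [← Int.norm_cast_real] using hm, rfl⟩

theorem jointEigenspace_le_iSup_weightSpace (k : Fin n → ℝ) :
    jointEigenspace E.δ Finset.univ k ≤ ⨆ l, E.weightSpace l := by
  by_cases hk : ∀ j, ∃ m : ℤ, (m : ℝ) = k j
  · choose l hl using hk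
    obtain rfl : (fun j => (l j : ℝ)) = k := funext hl
    exact (E.jointEigenspace_eq_weightSpace l).trans_le (le_iSup E.weightSpace l)
  · push Not at hk
    obtain ⟨j, hj⟩ := hk
    have hspec : (k j : ℂ) ∉ unboundedSpectrum (E.δ j) := by
      rw [E.spectrum_eq]
      rintro ⟨m, hm : (m : ℂ) = k j⟩
      exact hj m (by exact_mod_cast hm)
    refine fun x hx => ?_
    rw [(Submodule.eq_bot_iff _).1 (unboundedEigenspace_eq_bot hspec) x
      (mem_jointEigenspace.1 hx j (Finset.mem_univ j))]
    exact zero_mem _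

theorem topologicalClosure_iSup_weightSpace :
    (⨆ k, E.weightSpace k).topologicalClosure = ⊤ := by
  rw [Submodule.topologicalClosure_eq_top_iff, ← le_bot_iff,
    ← orthogonal_iSup_jointEigenspace (S := E.δ) (s := Finset.univ) (fun j _ => E.selfAdjoint j)
      (fun i _ j _ => E.commute i j) fun j _ => orthogonal_iSup_unboundedEigenspace
        (E.selfAdjoint j) (E.finite_spectrum_inter_closedBall j)]
  exact Submodule.orthogonal_le (iSup_le E.jointEigenspace_le_iSup_weightSpace)

theorem isHilbertSum_weightSpace : IsHilbertSum ℂ (fun k => E.weightSpace k)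
    fun k => (E.weightSpace k).subtypeₗᵢ :=
  .mkInternal _ E.orthogonalFamily_weightSpace E.topologicalClosure_iSup_weightSpace.ge

theorem mem_weightSpace_of_isCommutator_zero {a : H →L[ℂ] H}
    (ha : ∀ j, IsCommutator (E.δ j) a 0) (hx : x ∈ E.weightSpace k) : a x ∈ E.weightSpace k :=
  E.mem_weightSpace.2 fun j => (ha j).mem_unboundedEigenspace_zero (E.mem_weightSpace.1 hx j)

theorem mem_weightSpace_add_of_isCommutator {a : H →L[ℂ] H}
    (ha : ∀ j, IsCommutator (E.δ j) a ((l j : ℂ) • a)) (hx : x ∈ E.weightSpace k) :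
    a x ∈ E.weightSpace (k + l) := by
  refine E.mem_weightSpace.2 fun j => ?_
  rw [Pi.add_apply, Int.cast_add]
  exact (ha j).mem_unboundedEigenspace (E.mem_weightSpace.1 hx j)

theorem isCommutator_conjAdjoint {a S : H →L[ℂ] H} {j : Fin n} (h : IsCommutator (E.δ j) a S) :
    IsCommutator (E.δ j) (conjAdjoint T.J a) (conjAdjoint T.J S) := by
  simpa using h.conjAdjoint (E.selfAdjoint j) (by norm_num) (E.anticommute_J j) T.J_sq
    (krEps_mul_self d)

variable {a : A} {η : H →L[ℂ] H}

theorem π_mem_weightSpace (ha : a ∈ C.homogeneous l) (hx : x ∈ E.weightSpace k) :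
    T.π a x ∈ E.weightSpace (k + l) :=
  E.mem_weightSpace_add_of_isCommutator (fun j => by
    simpa only [C.deriv_of_mem_homogeneous ha, map_smul] using E.leibniz j a) hx

theorem rightMul_mem_weightSpace (ha : a ∈ C.homogeneous l) (hx : x ∈ E.weightSpace k) :
    T.rightMul a x ∈ E.weightSpace (k + l) :=
  E.mem_weightSpace_add_of_isCommutator (fun j => by
    simpa only [C.deriv_of_mem_homogeneous ha, map_smul, conjAdjoint_smul, rightMul] using
      E.isCommutator_conjAdjoint (E.leibniz j a)) hx

theorem rightForm_mem_weightSpace (hη : ∀ j, IsCommutator (E.δ j) η 0)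
    (hx : x ∈ E.weightSpace k) : T.rightForm η x ∈ E.weightSpace k :=
  zsmul_mem (E.mem_weightSpace_of_isCommutator_zero (fun j => by
    simpa only [conjAdjoint_zero] using E.isCommutator_conjAdjoint (hη j)) hx) (-krEps' d)

end TorusEquivariance

end RealSpectralTriple

/-! ### The twisted operators -/

namespace RealSpectralTriple

namespace TorusEquivariance

variable {A : Type*} [Ring A] [StarRing A] [Algebra ℂ A] [StarModule ℂ A]
  {H : Type*} [NormedAddCommGroup H] [InnerProductSpace ℂ H] [CompleteSpace H] {d n : ℕ}
  {T : RealSpectralTriple A H d} {C : TorusComoduleAlgebra n A} (E : T.TorusEquivariance C)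
  {Γ Z : H →L[ℂ] H} {ω : Fin n → H →L[ℂ] H} {k l : Fin n → ℤ} {x y : H}

theorem mem_baseDirac_graph : (x, y) ∈ (E.baseDirac Γ).graph ↔
    x ∈ E.weightSpace 0 ∧ (x, y) ∈ (T.horizontalDirac n Γ).graph := by
  simp only [mem_graph_iff_exists]
  constructor
  · rintro ⟨h, rfl⟩
    exact ⟨h.1, h.2, rfl⟩
  · rintro ⟨hx₀, hx, rfl⟩
    exact ⟨⟨hx₀, hx⟩, rfl⟩

theorem mem_weightSpace_of_mem_horizontalDirac_graph (hΓ : ∀ j, CommutesUpTo 1 (E.δ j) Γ)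
    (hx : x ∈ E.weightSpace k) (hxy : (x, y) ∈ (T.horizontalDirac n Γ).graph) :
    y ∈ E.weightSpace k := by
  have hΓk {z : H} (hz : z ∈ E.weightSpace k) : Γ z ∈ E.weightSpace k :=
    E.mem_weightSpace_of_isCommutator_zero (fun j => (hΓ j).isCommutator_zero) hz
  obtain ⟨u, v, hu, hv, rfl⟩ := mem_horizontalDirac_graph.1 hxy
  have hu : u ∈ E.weightSpace k := (E.isReducing_weightSpace k).mem_of_mem_graph hx hu
  have hv : v ∈ E.weightSpace k := (E.isReducing_weightSpace k).mem_of_mem_graph (hΓk hx) hv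
  exact Submodule.smul_mem _ _ (hΓk (add_mem (hΓk hu) (Submodule.smul_mem _ _ hv)))

theorem rightForm_connection (p : A) : T.rightForm (connection (T := T) ω k p) =
    T.rightForm (T.diff p) - ∑ i, (k i : ℂ) • (T.rightForm (ω i) * T.rightMul p) := by
  let rightFormHom : (H →L[ℂ] H) →ₗ[ℂ] (H →L[ℂ] H) :=
    { toFun := T.rightForm, map_add' := T.rightForm_add, map_smul' := T.rightForm_smul }
  change rightFormHom _ = _
  simp only [connection, map_sub, map_sum, map_smul]
  simp only [rightFormHom, LinearMap.coe_mk, AddHom.coe_mk, rightForm_mul]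

/-- The bounded operator `Z + ∑ k_i (· ω_i)`, which is `D - D_ω` on `H_k` when `Z` is the
fibre potential. -/
def twistPotential (T : RealSpectralTriple A H d) (Z : H →L[ℂ] H) (ω : Fin n → H →L[ℂ] H)
    (k : Fin n → ℤ) : H →L[ℂ] H :=
  Z + ∑ i, (k i : ℂ) • T.rightForm (ω i)

theorem twistPotential_apply (x : H) :
    twistPotential T Z ω k x = Z x + ∑ i, (k i : ℂ) • T.rightForm (ω i) x := by
  simp only [twistPotential, add_apply, sum_apply, smul_apply]

theorem isSelfAdjoint_twistPotential (hZ : IsSelfAdjoint Z) (hω : ∀ i, IsSelfAdjoint (ω i)) :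
    IsSelfAdjoint (twistPotential T Z ω k) :=
  hZ.add <| isSelfAdjoint_sum _ fun i _ =>
    (IsSelfAdjoint.intCast (k i)).smul (T.isSelfAdjoint_rightForm (hω i))

/-- `Z` is the bounded operator by which `D` differs from `D_0` on `H_0`: what isometric fibres
leave of the zeroth order term and of the vertical operator. -/
structure IsFibrePotential (Γ Z : H →L[ℂ] H) : Prop where
  isSelfAdjoint : IsSelfAdjoint Z
  commute_π : ∀ a, Commute Z (T.π a)
  commute_rightMul : ∀ a, Commute Z (T.rightMul a)
  baseDirac_eq : E.baseDirac Γ = subOn T.D Z (E.weightSpace 0)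

variable {E}

theorem HasIsometricFibres.exists_isFibrePotential (h : E.HasIsometricFibres Γ) :
    ∃ Z, E.IsFibrePotential Γ Z := by
  obtain ⟨Dv, Z, hD, hDv, -, -, hZπ, Z', hZ', hZZ'⟩ := h
  obtain rfl : Z = Z' := by simpa only [rightMul_one, one_mul, mul_one] using hZZ' 1
  refine ⟨Z, hZ', hZπ, fun a => (hZZ' a).symm, LinearPMap.eq_of_eq_graph ?_⟩
  ext ⟨x, y⟩
  rw [E.mem_baseDirac_graph, mem_graph_subOn]
  refine and_congr_right fun hx => ?_
  have mem_D_graph {w : H} : (x, w) ∈ T.D.graph ↔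
      ∃ h : x ∈ Dv.domain ⊓ (T.horizontalDirac n Γ).domain,
        Z x + T.horizontalDirac n Γ ⟨x, h.2⟩ = w := by
    conv_lhs => rw [hD, mem_graph_iff_exists]
    refine exists_congr fun h => ?_
    change Z x + (Dv ⟨x, h.1⟩ + T.horizontalDirac n Γ ⟨x, h.2⟩) = w ↔ _
    rw [hDv ⟨x, h.1⟩ hx, zero_add]
  constructor
  · intro hxy
    obtain ⟨u, -, hu, -, -⟩ := mem_horizontalDirac_graph.1 hxy
    obtain ⟨hx', rfl⟩ := mem_graph_iff_exists.1 hxy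
    exact mem_D_graph.2 ⟨⟨(mem_D_graph.1 hu).1.1, hx'⟩, add_comm _ _⟩
  · intro hxy
    obtain ⟨hx', hxy⟩ := mem_D_graph.1 hxy
    rw [add_comm, add_left_inj] at hxy
    exact mem_graph_iff_exists.2 ⟨hx'.2, hxy⟩

namespace IsFibrePotential

theorem mem_baseDirac_graph_iff (hZ : E.IsFibrePotential Γ Z) : (x, y) ∈ (E.baseDirac Γ).graph ↔
    x ∈ E.weightSpace 0 ∧ (x, y + Z x) ∈ T.D.graph := by
  rw [hZ.baseDirac_eq, mem_graph_subOn]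

theorem mem_weightSpace_zero (hZ : E.IsFibrePotential Γ Z) (hΓ : ∀ j, CommutesUpTo 1 (E.δ j) Γ)
    (hx : x ∈ E.weightSpace 0) : Z x ∈ E.weightSpace 0 := by
  have hred := E.isReducing_weightSpace 0
  rw [← topologicalClosure_domain_subOn (B := Z) hred T.selfAdjoint.dense_domain] at hx
  refine closure_minimal (t := Z ⁻¹' (E.weightSpace 0 : Set H)) (fun u hu => ?_)
    ((E.isClosed_weightSpace 0).preimage Z.continuous) hx
  obtain ⟨hu₀, hDu⟩ := mem_graph_subOn.1 ((subOn T.D Z (E.weightSpace 0)).mem_graph ⟨u, hu⟩)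
  have hD₀u := (E.mem_baseDirac_graph.1 (hZ.mem_baseDirac_graph_iff.2 ⟨hu₀, hDu⟩)).2
  exact (Submodule.add_mem_iff_right _ (E.mem_weightSpace_of_mem_horizontalDirac_graph hΓ hu₀
    hD₀u)).1 (hred.mem_of_mem_graph hu₀ hDu)

theorem mem_weightSpace (hZ : E.IsFibrePotential Γ Z) (hC : C.IsPrincipal)
    (hΓ : ∀ j, CommutesUpTo 1 (E.δ j) Γ) (hx : x ∈ E.weightSpace k) : Z x ∈ E.weightSpace k := by
  refine T.mem_of_forall_rightMul_mem (K := (E.weightSpace k).comap (Z : H →ₗ[ℂ] H)) hC k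
    fun a ha b hb => ?_
  have hax : T.rightMul a x ∈ E.weightSpace 0 := by
    simpa only [add_neg_cancel] using E.rightMul_mem_weightSpace ha hx
  have hZb : Z (T.rightMul b (T.rightMul a x)) = T.rightMul b (Z (T.rightMul a x)) :=
    DFunLike.congr_fun (hZ.commute_rightMul b).eq _
  simpa only [Submodule.mem_comap, ContinuousLinearMap.coe_coe, hZb, zero_add] using
    E.rightMul_mem_weightSpace hb (hZ.mem_weightSpace_zero hΓ hax)

theorem twistPotential_mem_weightSpace (hZ : E.IsFibrePotential Γ Z)
    (hC : C.IsPrincipal) (hΓ : ∀ j, CommutesUpTo 1 (E.δ j) Γ)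
    (hω : ∀ i j, IsCommutator (E.δ j) (ω i) 0) :
    ∀ x ∈ E.weightSpace k, twistPotential T Z ω k x ∈ E.weightSpace k := by
  intro x hx
  rw [twistPotential_apply]
  exact add_mem (hZ.mem_weightSpace hC hΓ hx) <| sum_mem fun i _ =>
    Submodule.smul_mem _ _ (E.rightForm_mem_weightSpace (hω i) hx)

theorem twistRelation_le (hZ : E.IsFibrePotential Γ Z) :
    E.twistRelation Γ ω k ≤ (subOn T.D (twistPotential T Z ω k) (E.weightSpace k)).graph := by
  refine Submodule.span_le.2 ?_
  rintro _ ⟨h, p, hp, rfl⟩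
  obtain ⟨hh₀, hDh⟩ := hZ.mem_baseDirac_graph_iff.1 ((E.baseDirac Γ).mem_graph h)
  refine mem_graph_subOn.2 ⟨by simpa only [zero_add] using E.rightMul_mem_weightSpace hp hh₀, ?_⟩
  have hDhp := (T.isCommutator_rightMul p).mem_graph hDh
  have hZp : Z (T.rightMul p (h : H)) = T.rightMul p (Z (h : H)) :=
    DFunLike.congr_fun (hZ.commute_rightMul p).eq _
  convert hDhp using 2
  simp only [rightForm_connection, twistPotential_apply, map_add, hZp, sub_apply, sum_apply,
    smul_apply, mul_apply_eq_comp]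
  abel

theorem graph_subOn_eq_twistRelation (hZ : E.IsFibrePotential Γ Z)
    (hC : C.IsPrincipal) :
    (subOn T.D (twistPotential T Z ω k) (E.weightSpace k)).graph = E.twistRelation Γ ω k := by
  refine le_antisymm ?_ hZ.twistRelation_le
  rintro ⟨x, y⟩ hxy
  obtain ⟨hx, hDx⟩ := mem_graph_subOn.1 hxy
  have hx_dom : x ∈ (E.twistRelation Γ ω k).map (.fst ℂ H H) := by
    refine T.mem_of_forall_rightMul_mem hC k fun a ha b hb => ?_
    have hax : T.rightMul a x ∈ E.weightSpace 0 := by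
      simpa only [add_neg_cancel] using E.rightMul_mem_weightSpace ha hx
    obtain ⟨hDax, -⟩ := mem_graph_iff_exists.1 ((T.isCommutator_rightMul a).mem_graph hDx)
    have hax_dom : T.rightMul a x ∈ (E.baseDirac Γ).domain := by
      rw [hZ.baseDirac_eq]
      exact ⟨hax, hDax⟩
    exact ⟨_, Submodule.subset_span ⟨⟨_, hax_dom⟩, b, hb, rfl⟩, rfl⟩
  obtain ⟨⟨x, z⟩, hxz, rfl⟩ := hx_dom
  rwa [LinearPMap.mem_graph_snd_inj _ hxy (hZ.twistRelation_le hxz) rfl]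

theorem twist_eq_subOn (hZ : E.IsFibrePotential Γ Z) (hC : C.IsPrincipal) :
    E.twist Γ ω k = subOn T.D (twistPotential T Z ω k) (E.weightSpace k) := by
  refine LinearPMap.eq_of_eq_graph ?_
  rw [twist, ← hZ.graph_subOn_eq_twistRelation hC]
  exact Submodule.toLinearPMap_graph_eq _ fun v => LinearPMap.graph_fst_eq_zero_snd _

theorem isClosed_twist (hZ : E.IsFibrePotential Γ Z) (hC : C.IsPrincipal) (k : Fin n → ℤ) :
    (E.twist Γ ω k).IsClosed := by
  rw [hZ.twist_eq_subOn hC]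
  exact isClosed_subOn T.selfAdjoint.isClosed (E.isClosed_weightSpace k)

theorem topologicalClosure_domain_twist (hZ : E.IsFibrePotential Γ Z) (hC : C.IsPrincipal) :
    (E.twist Γ ω k).domain.topologicalClosure = E.weightSpace k := by
  rw [hZ.twist_eq_subOn hC]
  exact topologicalClosure_domain_subOn (E.isReducing_weightSpace k) T.selfAdjoint.dense_domain

theorem graph_twist_le_prod (hZ : E.IsFibrePotential Γ Z) (hC : C.IsPrincipal)
    (hΓ : ∀ j, CommutesUpTo 1 (E.δ j) Γ) (hω : ∀ i j, IsCommutator (E.δ j) (ω i) 0)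
    (k : Fin n → ℤ) :
    (E.twist Γ ω k).graph ≤ (E.weightSpace k).prod (E.weightSpace k) := by
  rw [hZ.twist_eq_subOn hC]
  exact graph_subOn_le_prod (E.isReducing_weightSpace k)
    (hZ.twistPotential_mem_weightSpace hC hΓ hω)

theorem adjoint_graph_twist_inf_prod (hZ : E.IsFibrePotential Γ Z) (hC : C.IsPrincipal)
    (hΓ : ∀ j, CommutesUpTo 1 (E.δ j) Γ) (hω : ∀ i j, IsCommutator (E.δ j) (ω i) 0)
    (hsa : ∀ i, IsSelfAdjoint (ω i)) (k : Fin n → ℤ) :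
    (E.twist Γ ω k).graph.adjoint ⊓ (E.weightSpace k).prod (E.weightSpace k) =
      (E.twist Γ ω k).graph := by
  rw [hZ.twist_eq_subOn hC]
  exact adjoint_graph_subOn_inf_prod T.selfAdjoint
    (isSelfAdjoint_twistPotential hZ.isSelfAdjoint hsa) (E.isReducing_weightSpace k)
    (hZ.twistPotential_mem_weightSpace hC hΓ hω)

theorem mem_graph_twist_add (hZ : E.IsFibrePotential Γ Z) (hC : C.IsPrincipal)
    (hω : ∀ i, ω i ∈ T.oneForms ⊤) {a : A} (ha : a ∈ C.homogeneous l)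
    (hxy : (x, y) ∈ (E.twist Γ ω k).graph) :
    (T.π a x, T.π a y + (T.diff a - ∑ i, (l i : ℂ) • (T.rightForm (ω i) * T.π a)) x) ∈
      (E.twist Γ ω (k + l)).graph := by
  rw [hZ.twist_eq_subOn hC, mem_graph_subOn] at hxy ⊢
  refine ⟨E.π_mem_weightSpace ha hxy.1, ?_⟩
  have hDax := (T.isCommutator_diff a).mem_graph hxy.2
  have hZa : Z (T.π a x) = T.π a (Z x) := DFunLike.congr_fun (hZ.commute_π a).eq x
  have hωa (i : Fin n) : T.rightForm (ω i) (T.π a x) = T.π a (T.rightForm (ω i) x) :=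
    DFunLike.congr_fun (T.commute_rightForm (hω i) a).eq x
  convert hDax using 2
  simp only [twistPotential_apply, sub_apply, sum_apply, smul_apply, mul_apply_eq_comp, map_add,
    map_sum, map_smul, hZa, hωa, Pi.add_apply, Int.cast_add, add_smul, Finset.sum_add_distrib]
  abel

theorem exists_isCommutator_twistSum (hZ : E.IsFibrePotential Γ Z) (hC : C.IsPrincipal)
    (hω : ∀ i, ω i ∈ T.oneForms ⊤)
    (hsum : (E.twistSum Γ ω).graph = ⨆ k, (E.twist Γ ω k).graph) (a : A) :
    ∃ S, IsCommutator (E.twistSum Γ ω) (T.π a) S := by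
  induction C.mem_iSup_homogeneous a using Submodule.iSup_induction' with
  | mem l a ha =>
    exact ⟨_, isCommutator_algebraicDirectSum hsum (· + l) fun _ _ _ hxy =>
      hZ.mem_graph_twist_add hC hω ha hxy⟩
  | zero => exact ⟨0, by rw [map_zero]; exact .zero⟩
  | add a b _ _ ha hb =>
    obtain ⟨S, hS⟩ := ha
    obtain ⟨R, hR⟩ := hb
    exact ⟨S + R, by rw [map_add]; exact hS.add hR⟩

end IsFibrePotential

end TorusEquivariance

end RealSpectralTriple

end

theorem mainTheorem3_general
    {A : Type*} [Ring A] [StarRing A] [Algebra ℂ A] [StarModule ℂ A]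
    {H : Type*} [NormedAddCommGroup H] [InnerProductSpace ℂ H] [CompleteSpace H]
    {n d : ℕ} (C : TorusComoduleAlgebra n A) (hC : C.IsPrincipal)
    (T : RealSpectralTriple A H d) (E : T.TorusEquivariance C)
    (Γ : H →L[ℂ] H) (hΓ : ∀ j, CommutesUpTo 1 (E.δ j) Γ) (hfib : E.HasIsometricFibres Γ)
    (ω : Fin n → H →L[ℂ] H) (hω : ∀ i, ω i ∈ T.oneForms ⊤)
    (hinv : ∀ i j, IsCommutator (E.δ j) (ω i) 0) :
    (∀ k : Fin n → ℤ,
      (E.twist Γ ω k).graph = E.twistRelation Γ ω k ∧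
      (E.twist Γ ω k).domain.topologicalClosure = E.weightSpace k ∧
      ∀ x, E.twist Γ ω k x ∈ E.weightSpace k) ∧
    (OrthogonalFamily ℂ (fun k => E.weightSpace k) (fun k => (E.weightSpace k).subtypeₗᵢ) ∧
      (⨆ k, E.weightSpace k).topologicalClosure = ⊤ ∧
      (E.twistSum Γ ω).graph = (⨆ k, (E.twist Γ ω k).graph) ∧
      (E.twistSum Γ ω).IsClosable) ∧
    ((∀ i, IsSelfAdjoint (ω i)) → IsSelfAdjoint (E.twistedDirac Γ ω)) ∧
    (∀ a : A, ∃ S : H →L[ℂ] H, IsCommutator (E.twistedDirac Γ ω) (T.π a) S) := by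
  obtain ⟨Z, hZ⟩ := hfib.exists_isFibrePotential
  have hprod := hZ.graph_twist_le_prod hC hΓ hinv
  have hclosed := hZ.isClosed_twist (ω := ω) hC
  have hH := E.isHilbertSum_weightSpace
  have hsum : (E.twistSum Γ ω).graph = ⨆ k, (E.twist Γ ω k).graph :=
    graph_algebraicDirectSum hH hprod hclosed
  have hclosable : (E.twistSum Γ ω).IsClosable := isClosable_algebraicDirectSum hH hprod hclosed
  refine ⟨fun k => ⟨?_, hZ.topologicalClosure_domain_twist hC,
      fun x => (hprod k ((E.twist Γ ω k).mem_graph x)).2⟩,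
    ⟨E.orthogonalFamily_weightSpace, E.topologicalClosure_iSup_weightSpace, hsum, hclosable⟩,
    fun hsa => isSelfAdjoint_closure_algebraicDirectSum hH hprod hclosed
      (hZ.adjoint_graph_twist_inf_prod hC hΓ hinv hsa), fun a => ?_⟩
  · rw [hZ.twist_eq_subOn hC, hZ.graph_subOn_eq_twistRelation hC]
  · obtain ⟨S, hS⟩ := hZ.exists_isCommutator_twistSum hC hω hsum a
    exact ⟨S, hS.closure hclosable⟩

theorem mainTheorem3
    {A : Type*} [Ring A] [StarRing A] [Algebra ℂ A] [StarModule ℂ A]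
    {H : Type*} [NormedAddCommGroup H] [InnerProductSpace ℂ H] [CompleteSpace H]
    {n d : ℕ} (C : TorusComoduleAlgebra n A) (hC : C.IsPrincipal)
    (T : RealSpectralTriple A H d) (E : T.TorusEquivariance C)
    (Γ : H →L[ℂ] H) (hΓ : E.IsProjectable Γ) (hfib : E.HasIsometricFibres Γ)
    (ω : Fin n → H →L[ℂ] H) (hω : E.IsStrongConnection ω) :
    -- each twist `D_ω^(k)` is a well-defined, densely defined operator on `H_k`
    (∀ k : Fin n → ℤ,
      (E.twist Γ ω k).graph = E.twistRelation Γ ω k ∧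
      (E.twist Γ ω k).domain.topologicalClosure = E.weightSpace k ∧
      ∀ x, E.twist Γ ω k x ∈ E.weightSpace k) ∧
    -- `H` is the Hilbert sum of the `H_k`, and the direct sum of the twists is a closable operator
    (OrthogonalFamily ℂ (fun k => E.weightSpace k) (fun k => (E.weightSpace k).subtypeₗᵢ) ∧
      (⨆ k, E.weightSpace k).topologicalClosure = ⊤ ∧
      (E.twistSum Γ ω).graph = (⨆ k, (E.twist Γ ω k).graph) ∧
      (E.twistSum Γ ω).IsClosable) ∧
    -- `D_ω` is self-adjoint as soon as all the `ω_i` are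
    ((∀ i, IsSelfAdjoint (ω i)) → IsSelfAdjoint (E.twistedDirac Γ ω)) ∧
    -- `D_ω` has bounded commutators with `A`
    (∀ a : A, ∃ S : H →L[ℂ] H, IsCommutator (E.twistedDirac Γ ω) (T.π a) S) :=
  mainTheorem3_general C hC T E Γ hΓ.commute_δ hfib ω hω.mem hω.invariant
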